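/- Let $N\ge 1$, let $Y_0,\dots,Y_{N+1}$ and $D$ be smooth vector fields on $\mathbb R^d$ (viewed as first order differential operators), and suppose that $$[Y_0,Y_j]=Y_{j+1}\ (1\le j\le N),\quad [Y_0,Y_{N+1}]=0,\quad [Y_i,Y_j]=0\ (1\le i,j\le N+1),\quad [Y_i,D]=\kappa_iY_i\ (0\le i\le N+1)$$ with constants $\kappa_i\in(0,\infty)$. For $\lambda>0$ put $L=Y_1^2+Y_0-\lambda D$, and let $P_t=e^{tL}$ be a Markov semigroup generated by $L$, i.e. $P_t(x,\cdot)$ is the law at time $t$ of a non-explosive diffusion with generator $L$ (a solution of the martingale problem with continuous paths) started at $x$. Let $m_0,\dots,m_{N+1}\in(0,\infty)$. For $k=(k_1,\dots,k_n)\in\{0,\dots,N+1\}^n$ put $Y_{k,n}=Y_{k_1}\cdots Y_{k_n}$, $m_k=\sum_j m_{k_j}$, and $$\widetilde\Gamma^{(n)}_t(g)=\sum_{k\in\{0,\dots,N+1\}^n}e^{m_kt}\,|Y_{k,n}g|^2 .$$ Let $f$ be a smooth bounded function and $f_t=P_tf$. Assume that $f_t$ is a classical solution of $\partial_tf_t=Lf_t$: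 it is smooth on $(0,\infty)\times\mathbb R^d$, and its derivatives $Y_{k,n}f_t$ of order $n$ are continuous on $[0,\infty)\times\mathbb R^d$ and bounded on $[0,T]\times\mathbb R^d$ for every $T<\infty$. Then for every $n$ there is $\lambda_0\in(0,\infty)$, depending only on $N$, $n$, $(\kappa_i)$ and $(m_i)$, such that for every $\lambda\ge\lambda_0$, all $t>0$ and all $k\in\{0,\dots,N+1\}^n$, pointwise on $\mathbb R^d$, $$\widetilde\Gamma^{(n)}_t(f_t)\le P_t\,\widetilde\Gamma^{(n)}_0(f),\qquad |Y_{k,n}f_t|^2\le e^{-m_kt}\,P_t\,\widetilde\Gamma^{(n)}_0(f).$$ Consequently $$\sup_{\mathbb R^d}\widetilde\Gamma^{(n)}_t(f_t)\le\sup_{\mathbb R^d}\widetilde\Gamma^{(n)}_0(f),\qquad |Y_{k,n}f_t|^2\le e^{-m_kt}\sup_{\mathbb R^d}\widetilde\Gamma^{(n)}_0(f).$$ No further relation among the weights is needed for this; in particular the weights may satisfy $m_0=m_2$, $m_1=1$, $m_j\ge m_{j+1}$ for $j\ge1$. If moreover $m_0=m_2$ and $m_j\le m_{j+1}$ for $1\le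 j\le N$, then (with the same $\lambda_0$) the weighted sum is nonincreasing along the semigroup: $\widetilde\Gamma^{(n)}_t(f_t)\le P_{t-s}\,\widetilde\Gamma^{(n)}_s(f_s)$ pointwise for $0\le s\le t$, and $t\mapsto\sup_{\mathbb R^d}\widetilde\Gamma^{(n)}_t(f_t)$ is nonincreasing on $[0,\infty)$. -/

import Mathlib

open MeasureTheory ProbabilityTheory Set
open scoped NNReal ContDiff

noncomputable section

/-- A vector field `V` on `ℝᵈ` acting on functions as a first order differential operator:
`(V f)(x) = Df(x)[V(x)]`. -/
def fieldDeriv {d : ℕ} (V : EuclideanSpace ℝ (Fin d) → EuclideanSpace ℝ (Fin d))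
    (f : EuclideanSpace ℝ (Fin d) → ℝ) : EuclideanSpace ℝ (Fin d) → ℝ :=
  fun x => fderiv ℝ f x (V x)

/-- `Y_{k,n} f = Y_{k₁} (Y_{k₂} (⋯ (Y_{kₙ} f)))`. -/
def iterFieldDeriv {d N n : ℕ}
    (Y : Fin (N + 2) → EuclideanSpace ℝ (Fin d) → EuclideanSpace ℝ (Fin d))
    (k : Fin n → Fin (N + 2)) (f : EuclideanSpace ℝ (Fin d) → ℝ) :
    EuclideanSpace ℝ (Fin d) → ℝ :=
  (List.ofFn k).foldr (fun i g => fieldDeriv (Y i) g) f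

/-- The generator `L = Y₁² + Y₀ - lam D`. -/
def generator {d N : ℕ}
    (Y : Fin (N + 2) → EuclideanSpace ℝ (Fin d) → EuclideanSpace ℝ (Fin d))
    (D : EuclideanSpace ℝ (Fin d) → EuclideanSpace ℝ (Fin d)) (lam : ℝ)
    (f : EuclideanSpace ℝ (Fin d) → ℝ) : EuclideanSpace ℝ (Fin d) → ℝ :=
  fun x => fieldDeriv (Y 1) (fieldDeriv (Y 1) f) x + fieldDeriv (Y 0) f x
    - lam * fieldDeriv D f x

/-- Smooth vector fields `Y₀, …, Y_{N+1}` and `D` on `ℝᵈ` with the filiform commutation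
relations and full dilation. Mathlib's `lieBracket ℝ V W` is the field of the commutator
`V W - W V` of the operators. -/
structure IsFiliformWithDilation {d N : ℕ}
    (Y : Fin (N + 2) → EuclideanSpace ℝ (Fin d) → EuclideanSpace ℝ (Fin d))
    (D : EuclideanSpace ℝ (Fin d) → EuclideanSpace ℝ (Fin d))
    (κ : Fin (N + 2) → ℝ) : Prop where
  smooth_Y : ∀ i, ContDiff ℝ ∞ (Y i)
  smooth_D : ContDiff ℝ ∞ D
  /-- `[Y₀, Yⱼ] = Y_{j+1}` for `1 ≤ j ≤ N`. -/
  bracket_succ : ∀ j : Fin (N + 1), j ≠ 0 →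
    VectorField.lieBracket ℝ (Y 0) (Y j.castSucc) = Y j.succ
  /-- `[Y₀, Y_{N+1}] = 0`. -/
  bracket_last : VectorField.lieBracket ℝ (Y 0) (Y (Fin.last (N + 1))) = 0
  /-- `[Yᵢ, Yⱼ] = 0` for `1 ≤ i, j ≤ N + 1`. -/
  bracket_comm : ∀ i j : Fin (N + 2), i ≠ 0 → j ≠ 0 →
    VectorField.lieBracket ℝ (Y i) (Y j) = 0
  /-- `[Yᵢ, D] = κᵢ Yᵢ` for `0 ≤ i ≤ N + 1`. -/
  bracket_dilation : ∀ i, VectorField.lieBracket ℝ (Y i) D = κ i • Y i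

/-- The process `φ(t, X_t) - φ(0, X_0) - ∫₀ᵗ (∂ₛφ + A φ(s, ·))(s, X_s) ds`. -/
def martingaleProblemProcess {d : ℕ} {S : Type}
    (A : (EuclideanSpace ℝ (Fin d) → ℝ) → EuclideanSpace ℝ (Fin d) → ℝ)
    (X : ℝ≥0 → S → EuclideanSpace ℝ (Fin d))
    (φ : ℝ × EuclideanSpace ℝ (Fin d) → ℝ) : ℝ≥0 → S → ℝ :=
  fun t w => φ ((t : ℝ), X t w) - φ (0, X 0 w)
    - ∫ s in (0 : ℝ)..(t : ℝ),
        (deriv (fun r => φ (r, X s.toNNReal w)) s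
          + A (fun y => φ (s, y)) (X s.toNNReal w))

/-- `X` is an `ℝᵈ`-valued diffusion process with generator `A` started at `x`: it has continuous
paths (so it does not explode) and solves the martingale problem for `A`, i.e. the process above
is a local martingale for every smooth space-time function `φ`. -/
structure IsDiffusion {d : ℕ} {S : Type} [mS : MeasurableSpace S] (μ : Measure S)
    (ℱ : Filtration ℝ≥0 mS)
    (A : (EuclideanSpace ℝ (Fin d) → ℝ) → EuclideanSpace ℝ (Fin d) → ℝ)
    (x : EuclideanSpace ℝ (Fin d)) (X : ℝ≥0 → S → EuclideanSpace ℝ (Fin d)) : Prop where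
  adapted : StronglyAdapted ℱ X
  continuous_paths : ∀ w, Continuous fun t => X t w
  start : ∀ᵐ w ∂μ, X 0 w = x
  martingaleProblem : ∀ φ : ℝ × EuclideanSpace ℝ (Fin d) → ℝ, ContDiff ℝ ∞ φ →
    Locally (fun M : ℝ≥0 → S → ℝ => Martingale M ℱ μ) ℱ (martingaleProblemProcess A X φ) μ

/-- `P` is a (conservative) Markov semigroup `e^{tA}` on `ℝᵈ` generated by `A`: a semigroup of
Markov kernels such that `P t x` is the law at time `t` of a diffusion with generator `A` started
at `x`. -/
structure IsMarkovSemigroup {d : ℕ}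
    (A : (EuclideanSpace ℝ (Fin d) → ℝ) → EuclideanSpace ℝ (Fin d) → ℝ)
    (P : ℝ≥0 → Kernel (EuclideanSpace ℝ (Fin d)) (EuclideanSpace ℝ (Fin d))) : Prop where
  markov : ∀ t, IsMarkovKernel (P t)
  zero : P 0 = Kernel.id
  add : ∀ s t, P (s + t) = (P t).comp (P s)
  diffusion : ∀ x, ∃ (S : Type) (mS : MeasurableSpace S) (μ : Measure S)
    (ℱ : Filtration ℝ≥0 mS) (X : ℝ≥0 → S → EuclideanSpace ℝ (Fin d)),
      IsProbabilityMeasure μ ∧ IsDiffusion μ ℱ A x X ∧ ∀ t, μ.map (X t) = P t x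

/-- `(P_t g)(x) = ∫ g(y) P_t(x, dy)`, for real times `t ≥ 0`. -/
def semigroupApply {d : ℕ}
    (P : ℝ≥0 → Kernel (EuclideanSpace ℝ (Fin d)) (EuclideanSpace ℝ (Fin d)))
    (t : ℝ) (g : EuclideanSpace ℝ (Fin d) → ℝ) : EuclideanSpace ℝ (Fin d) → ℝ :=
  fun x => ∫ y, g y ∂(P t.toNNReal x)

/-- The trajectory `u t = e^{tA} f` is a classical solution of `∂ₜu = A u` whose `n`-th order
derivatives `Y_{k₁}⋯Y_{kₙ} u` are continuous up to time `0` and bounded on `[0, T] × ℝᵈ` for each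
finite `T` (with an arbitrary bound, depending on `T` and on the trajectory). -/
structure IsRegularTrajectory {d N : ℕ}
    (Y : Fin (N + 2) → EuclideanSpace ℝ (Fin d) → EuclideanSpace ℝ (Fin d))
    (A : (EuclideanSpace ℝ (Fin d) → ℝ) → EuclideanSpace ℝ (Fin d) → ℝ)
    (n : ℕ) (u : ℝ → EuclideanSpace ℝ (Fin d) → ℝ) : Prop where
  smooth : ContDiffOn ℝ ∞ (fun p : ℝ × EuclideanSpace ℝ (Fin d) => u p.1 p.2) (Ioi 0 ×ˢ univ)
  equation : ∀ t, 0 < t → ∀ x, HasDerivAt (fun s => u s x) (A (u t) x) t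
  continuous_deriv : ∀ k : Fin n → Fin (N + 2),
    ContinuousOn (fun p : ℝ × EuclideanSpace ℝ (Fin d) => iterFieldDeriv Y k (u p.1) p.2)
      (Ici 0 ×ˢ univ)
  bounded_deriv : ∀ (k : Fin n → Fin (N + 2)) (T : ℝ), ∃ C : ℝ, ∀ t ∈ Icc 0 T, ∀ x,
    |iterFieldDeriv Y k (u t) x| ≤ C

/-- `Γ_t^{(n)}(g)(x) = ∑_k e^{m_k t} |Y_{k₁}⋯Y_{kₙ} g(x)|²` with `m_k = ∑ⱼ m_{kⱼ}`, the sum being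
over all `k ∈ {0, …, N+1}ⁿ`. -/
def weightedGamma {d N : ℕ}
    (Y : Fin (N + 2) → EuclideanSpace ℝ (Fin d) → EuclideanSpace ℝ (Fin d))
    (m : Fin (N + 2) → ℝ) (n : ℕ) (t : ℝ) (g : EuclideanSpace ℝ (Fin d) → ℝ) :
    EuclideanSpace ℝ (Fin d) → ℝ :=
  fun x => ∑ k : Fin n → Fin (N + 2),
    Real.exp ((∑ j, m (k j)) * t) * |iterFieldDeriv Y k g x| ^ 2

end

/-!
The weighted sum `Γ_t(f_t) = ∑_k e^{m_k t} |Y_k f_t|²` is a subsolution of the heat equation of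
`L = Y₁² + Y₀ - lam D`, and a bounded subsolution lies below its evolution under the Markov
semigroup.

For the subsolution property the word `Y_k = Y_{k₁} ⋯ Y_{kₙ}` is commuted past `L`. The dilation
contributes `-lam κ_k Y_k`, a damping that grows with `lam`. The commutator with `Y₁² + Y₀` is a
combination of words `Y_l` of the same length and of terms `2 Y₁ Y_l`, the latter because
`[Y₀, Y₁²] = 2 Y₁ Y₂` (`word_mul_sub_mul_word`). In `(∂ₜ - L) Γ_t(f_t)` the terms `Y₁ Y_l f` are
absorbed by the carré du champ terms `-2 |Y₁ Y_l f|²` and all others by the damping, provided `lam`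
is large (`exists_forall_weighted_energy_nonneg`). This is uniform in time when the weights satisfy
`m₀ = m₂` and `m₁ ≤ m₂ ≤ ⋯ ≤ m_{N+1}`, since then a word is only ever exchanged against words of at
least the same weight. The threshold depends on the words alone, not on the vector fields.

The comparison (`IsMarkovSemigroup.subsolution_le_semigroupApply`) runs the subsolution backwards
along the diffusion. By the martingale problem the result is a local martingale plus an increasing
process; boundedness removes the localization, and continuity at time zero and of the paths covers
the initial time. The martingale problem requires test functions smooth for all times, whence the
positive time change of `exists_smooth_pos_eq_sub`.

General weights need no separate argument for the bounds from time zero: `Γ_0` does not depend on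
the weights, `Γ_t` increases with them, and constant weights satisfy the monotonicity condition, so
all weights may be replaced by the constant `∑ᵢ mᵢ`.
-/

/-! ### Commuting words past the generator -/

/-- The words `l` for which `2 Y₁ Y_l` occurs in the normal form of `[Y_k, Y₁² + Y₀]`: one
letter `0` of `k` is replaced by `2`, according to `[Y₀, Y₁²] = 2 Y₁ Y₂`. -/
def transferWords {N : ℕ} : List (Fin (N + 2)) → List (List (Fin (N + 2)))
  | [] => []
  | i :: k => (transferWords k).map (i :: ·) ++ if i = 0 then [2 :: k] else []

/-- The pairs `(c, l)` for which `c Y_l` occurs in the normal form of `[Y_k, Y₁² + Y₀]`. Either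
one letter `i` of `k` is raised to `i + 1`, according to `[Yᵢ, Y₀] = -Y_{i+1}`, or two letters `0`
become `2`: the second one because `Y₁` has to pass a `Y₀` on its way to the front. -/
def remainderWords {N : ℕ} : List (Fin (N + 2)) → List (ℝ × List (Fin (N + 2)))
  | [] => []
  | i :: k => (remainderWords k).map (fun q => (q.1, i :: q.2)) ++
      if i = 0 then (transferWords k).map (fun l => (2, 2 :: l))
      else if i = Fin.last (N + 1) then [] else [(-1, (i + 1) :: k)]

section Commutators

variable {N : ℕ} {R : Type*} [Ring R] [Algebra ℝ R]

/-- Normal form of the commutator of a word with `Y₁² + Y₀`, with `Y₁` moved to the front. -/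
theorem word_mul_sub_mul_word (y : Fin (N + 2) → R)
    (h01 : y 0 * y 1 = y 1 * y 0 + y 2)
    (hsucc : ∀ i, i ≠ 0 → i ≠ Fin.last (N + 1) → y 0 * y i = y i * y 0 + y (i + 1))
    (hlast : y 0 * y (Fin.last (N + 1)) = y (Fin.last (N + 1)) * y 0)
    (hcomm : ∀ i, i ≠ 0 → y i * y 1 = y 1 * y i) (h2 : (2 : Fin (N + 2)) ≠ 0)
    (k : List (Fin (N + 2))) :
    (k.map y).prod * (y 1 * y 1 + y 0) - (y 1 * y 1 + y 0) * (k.map y).prod =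
      ((transferWords k).map fun l => (2 : ℝ) • (y 1 * (l.map y).prod)).sum +
      ((remainderWords k).map fun q => q.1 • (q.2.map y).prod).sum := by
  induction k with
  | nil => simp [transferWords, remainderWords]
  | cons i k ih =>
    set W := (k.map y).prod with hW
    set L := y 1 * y 1 + y 0 with hL
    have hrec : y i * W * L - L * (y i * W) =
        y i * (W * L - L * W) + (y i * L - L * y i) * W := by noncomm_ring
    simp only [List.map_cons, List.prod_cons, transferWords, remainderWords, ← hW]
    rw [hrec, ih]
    simp only [List.map_append, List.sum_append, List.map_map, mul_add, ← List.sum_map_mul_left,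
      Function.comp_def, List.map_cons, List.prod_cons, mul_smul_comm]
    by_cases hi0 : i = 0
    · subst hi0
      have hbr : (y 0 * L - L * y 0) * W = (2 : ℝ) • (y 1 * (y 2 * W)) := by
        have h : y 0 * L - L * y 0 = 2 * (y 1 * y 2) := by
          have e : y 0 * L - L * y 0 = (y 0 * y 1) * y 1 - y 1 * (y 1 * y 0) := by
            rw [hL]; noncomm_ring
          rw [e, h01, add_mul, mul_assoc, h01, hcomm 2 h2]; noncomm_ring
        rw [h, two_smul]; noncomm_ring
      have hmove : ((transferWords k).map fun l => (2 : ℝ) • (y 0 * (y 1 * (l.map y).prod))).sum =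
          ((transferWords k).map fun l => (2 : ℝ) • (y 1 * (y 0 * (l.map y).prod))).sum +
          ((transferWords k).map fun l => (2 : ℝ) • (y 2 * (l.map y).prod)).sum := by
        rw [← List.sum_map_add]
        congr 2
        funext l
        rw [← smul_add, ← mul_assoc, h01, add_mul, mul_assoc]
      rw [hbr, hmove]
      simp only [if_true, List.map_map, Function.comp_def, List.map_cons, List.prod_cons,
        List.map_nil, List.sum_cons, List.sum_nil, ← hW]
      abel
    · have hmove : ((transferWords k).map fun l => (2 : ℝ) • (y i * (y 1 * (l.map y).prod))).sum =
          ((transferWords k).map fun l => (2 : ℝ) • (y 1 * (y i * (l.map y).prod))).sum := by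
        congr 2
        funext l
        rw [← mul_assoc, hcomm i hi0, mul_assoc]
      have hbr : y i * L - L * y i = y i * y 0 - y 0 * y i := by
        have e : y i * L - L * y i = (y i * y 1) * y 1 - y 1 * (y 1 * y i) +
            (y i * y 0 - y 0 * y i) := by rw [hL]; noncomm_ring
        rw [e, hcomm i hi0, mul_assoc, hcomm i hi0]; abel
      rw [hmove, hbr]
      by_cases hil : i = Fin.last (N + 1)
      · simp [hil, hlast]
      · simp only [hi0, hil, if_false, List.map_cons, List.map_nil, List.prod_cons, List.sum_cons,
          List.sum_nil, ← hW, hsucc i hi0 hil]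
        simp only [neg_smul, one_smul]
        noncomm_ring

theorem word_mul_dilation (y : Fin (N + 2) → R) (D : R) (κ : Fin (N + 2) → ℝ)
    (h : ∀ i, y i * D = D * y i + κ i • y i) (k : List (Fin (N + 2))) :
    (k.map y).prod * D = D * (k.map y).prod + (k.map κ).sum • (k.map y).prod := by
  induction k with
  | nil => simp
  | cons i k ih =>
    simp only [List.map_cons, List.prod_cons, List.sum_cons]
    rw [mul_assoc, ih, mul_add, ← mul_assoc, h, add_mul, add_smul, mul_smul_comm, smul_mul_assoc,
      mul_assoc]
    abel

/-- Normal form of a word times the generator `Y₁² + Y₀ - lam D`. -/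
theorem word_mul_generator (y : Fin (N + 2) → R) (D : R) (κ : Fin (N + 2) → ℝ) (lam : ℝ)
    (h01 : y 0 * y 1 = y 1 * y 0 + y 2)
    (hsucc : ∀ i, i ≠ 0 → i ≠ Fin.last (N + 1) → y 0 * y i = y i * y 0 + y (i + 1))
    (hlast : y 0 * y (Fin.last (N + 1)) = y (Fin.last (N + 1)) * y 0)
    (hcomm : ∀ i, i ≠ 0 → y i * y 1 = y 1 * y i) (h2 : (2 : Fin (N + 2)) ≠ 0)
    (hD : ∀ i, y i * D = D * y i + κ i • y i) (k : List (Fin (N + 2))) :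
    (k.map y).prod * (y 1 * y 1 + y 0 - lam • D) =
      (y 1 * y 1 + y 0 - lam • D) * (k.map y).prod - (lam * (k.map κ).sum) • (k.map y).prod +
      (((transferWords k).map fun l => (2 : ℝ) • (y 1 * (l.map y).prod)).sum +
      ((remainderWords k).map fun q => q.1 • (q.2.map y).prod).sum) := by
  rw [← word_mul_sub_mul_word y h01 hsucc hlast hcomm h2, mul_sub, sub_mul _ _ (k.map y).prod,
    mul_smul_comm, word_mul_dilation y D κ hD, smul_mul_assoc, smul_add, mul_smul]
  abel

end Commutators

/-! ### The dissipation inequality -/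

section Energy

variable {N : ℕ} {m : Fin (N + 2) → ℝ}

theorem length_of_mem_transferWords {k l : List (Fin (N + 2))} (h : l ∈ transferWords k) :
    l.length = k.length := by
  induction k generalizing l with
  | nil => simp [transferWords] at h
  | cons i k ih =>
    simp only [transferWords, List.mem_append, List.mem_map] at h
    rcases h with ⟨l', hl', rfl⟩ | h
    · simp [ih hl']
    · split_ifs at h <;> simp_all

theorem weight_of_mem_transferWords (h02 : m 0 = m 2) {k l : List (Fin (N + 2))}
    (h : l ∈ transferWords k) : (l.map m).sum = (k.map m).sum := by
  induction k generalizing l with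
  | nil => simp [transferWords] at h
  | cons i k ih =>
    simp only [transferWords, List.mem_append, List.mem_map] at h
    rcases h with ⟨l', hl', rfl⟩ | h
    · simp [ih hl']
    · split_ifs at h <;> simp_all

theorem length_of_mem_remainderWords {k : List (Fin (N + 2))} {q : ℝ × List (Fin (N + 2))}
    (h : q ∈ remainderWords k) : q.2.length = k.length := by
  induction k generalizing q with
  | nil => simp [remainderWords] at h
  | cons i k ih =>
    simp only [remainderWords, List.mem_append, List.mem_map] at h
    rcases h with ⟨q', hq', rfl⟩ | h
    · simp [ih hq']
    · split_ifs at h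
      · obtain ⟨l, hl, rfl⟩ := List.mem_map.1 h
        simp [length_of_mem_transferWords hl]
      · simp at h
      · simp_all

theorem weight_le_of_mem_remainderWords (h02 : m 0 = m 2)
    (hmono : ∀ i, i ≠ 0 → i ≠ Fin.last (N + 1) → m i ≤ m (i + 1)) {k : List (Fin (N + 2))}
    {q : ℝ × List (Fin (N + 2))} (h : q ∈ remainderWords k) :
    (k.map m).sum ≤ (q.2.map m).sum := by
  induction k generalizing q with
  | nil => simp [remainderWords] at h
  | cons i k ih =>
    simp only [remainderWords, List.mem_append, List.mem_map] at h
    rcases h with ⟨q', hq', rfl⟩ | h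
    · simpa using ih hq'
    · split_ifs at h with hi hl
      · obtain ⟨l, hl, rfl⟩ := List.mem_map.1 h
        simp [weight_of_mem_transferWords h02 hl, hi, h02]
      · simp at h
      · rw [List.mem_singleton.1 h]
        simpa using hmono i hi hl

theorem List.abs_sum_map_mul_le {ι : Type*} (l : List ι) (c f : ι → ℝ) {S : ℝ}
    (h : ∀ i ∈ l, |f i| ≤ S) :
    |(l.map fun i => c i * f i).sum| ≤ (l.map fun i => |c i|).sum * S := by
  induction l with
  | nil => simp
  | cons a l ih =>
    simp only [List.map_cons, List.sum_cons, add_mul]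
    refine (abs_add_le _ _).trans (add_le_add ?_ (ih fun i hi => h i (by simp [hi])))
    rw [abs_mul]
    exact mul_le_mul_of_nonneg_left (h a (by simp)) (abs_nonneg _)

/-- The dissipation inequality. At a given point, `w l` stands for `Y_l u`, `z l` for `Y₁ Y_l u`,
and the sum for `(L - ∂_τ)` applied to the weighted sum of squares at time `τ`. -/
theorem exists_forall_weighted_energy_nonneg {κ : Fin (N + 2) → ℝ} (hκ : ∀ i, 0 < κ i)
    (h02 : m 0 = m 2) (hmono : ∀ i, i ≠ 0 → i ≠ Fin.last (N + 1) → m i ≤ m (i + 1)) (n : ℕ) :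
    ∃ lam₀ : ℝ, 0 < lam₀ ∧ ∀ lam, lam₀ ≤ lam → ∀ τ : ℝ, 0 ≤ τ →
      ∀ w z : List (Fin (N + 2)) → ℝ,
      0 ≤ ∑ k : Fin n → Fin (N + 2), Real.exp ((∑ j, m (k j)) * τ) *
        ((2 * lam * (∑ j, κ (k j)) - ∑ j, m (k j)) * w (List.ofFn k) ^ 2 +
          2 * z (List.ofFn k) ^ 2 -
          2 * w (List.ofFn k) *
            (((transferWords (List.ofFn k)).map fun l => 2 * z l).sum +
             ((remainderWords (List.ofFn k)).map fun q => q.1 * w q.2).sum)) := by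
  -- `cB` counts the terms `2 Y₁ Y_l`, `cA` is the total size of the coefficients of the `Y_l`
  set cB : (Fin n → Fin (N + 2)) → ℝ :=
    fun k => ((transferWords (List.ofFn k)).map fun _ => |(2 : ℝ)|).sum with hcB
  set cA : (Fin n → Fin (N + 2)) → ℝ :=
    fun k => ((remainderWords (List.ofFn k)).map fun q => |q.1|).sum with hcA
  have hcB0 : ∀ k, 0 ≤ cB k := fun k => List.sum_nonneg (by simp)
  set B := ∑ k, cB k with hB
  set A := ∑ k, cA k with hA
  have hB0 : 0 ≤ B := Finset.sum_nonneg fun k _ => hcB0 k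
  set C := B * (B + 1) + 2 * A with hC
  obtain ⟨lam₀, hlam₀, hlam⟩ : ∃ lam₀ : ℝ, 0 < lam₀ ∧ ∀ lam, lam₀ ≤ lam →
      ∀ k : Fin n → Fin (N + 2), C ≤ 2 * lam * (∑ j, κ (k j)) - ∑ j, m (k j) := by
    rcases Nat.eq_zero_or_pos n with rfl | hn
    · -- the empty word is not damped, but it also commutes with everything, so that `C = 0`
      refine ⟨1, one_pos, fun lam _ k => ?_⟩
      simp [hC, hB, hA, hcA, hcB, transferWords, remainderWords]
    · have : Nonempty (Fin n) := ⟨⟨0, hn⟩⟩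
      have hpos : ∀ k : Fin n → Fin (N + 2), 0 < ∑ j, κ (k j) := fun k =>
        Finset.sum_pos (fun j _ => hκ _) Finset.univ_nonempty
      set g : (Fin n → Fin (N + 2)) → ℝ := fun k => |C + ∑ j, m (k j)| / (∑ j, κ (k j)) with hg
      have hg0 : ∀ k, 0 ≤ g k := fun k => div_nonneg (abs_nonneg _) (hpos k).le
      refine ⟨1 + ∑ k, g k, add_pos_of_pos_of_nonneg one_pos
        (Finset.sum_nonneg fun k _ => hg0 k), fun lam hl k => ?_⟩
      have h1 : g k ≤ lam := by
        have := Finset.single_le_sum (fun k _ => hg0 k) (Finset.mem_univ k)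
        linarith
      have h2 : |C + ∑ j, m (k j)| ≤ lam * ∑ j, κ (k j) := (div_le_iff₀ (hpos k)).1 h1
      have h3 := le_abs_self (C + ∑ j, m (k j))
      have h4 := abs_nonneg (C + ∑ j, m (k j))
      linarith
  refine ⟨lam₀, hlam₀, fun lam hl τ hτ w z => ?_⟩
  set e : List (Fin (N + 2)) → ℝ := fun l => Real.exp ((l.map m).sum * τ) with he
  have he0 : ∀ l, 0 < e l := fun l => Real.exp_pos _
  have hek : ∀ k : Fin n → Fin (N + 2), Real.exp ((∑ j, m (k j)) * τ) = e (List.ofFn k) := by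
    intro k; simp [he, List.map_ofFn, List.sum_ofFn]
  simp only [hek]
  set S := ∑ k : Fin n → Fin (N + 2), e (List.ofFn k) * w (List.ofFn k) ^ 2 with hS
  set Q := ∑ k : Fin n → Fin (N + 2), e (List.ofFn k) * z (List.ofFn k) ^ 2 with hQ
  have single : ∀ (v : List (Fin (N + 2)) → ℝ) (l : List (Fin (N + 2))), l.length = n →
      e l * v l ^ 2 ≤ ∑ k : Fin n → Fin (N + 2), e (List.ofFn k) * v (List.ofFn k) ^ 2 := by
    intro v l hlen
    subst hlen
    have := Finset.single_le_sum (f := fun k : Fin l.length → Fin (N + 2) =>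
      e (List.ofFn k) * v (List.ofFn k) ^ 2)
      (fun k _ => mul_nonneg (he0 _).le (sq_nonneg _)) (Finset.mem_univ l.get)
    simpa using this
  have hQ0 : 0 ≤ Q := Finset.sum_nonneg fun k _ => mul_nonneg (he0 _).le (sq_nonneg _)
  -- Young's inequality with parameter `B + 1`, so that all transfer terms together cost at most `Q`
  have htransfer : ∀ k : Fin n → Fin (N + 2),
      2 * e (List.ofFn k) * w (List.ofFn k) *
        ((transferWords (List.ofFn k)).map fun l => 2 * z l).sum ≤
        cB k * ((B + 1) * S + Q / (B + 1)) := by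
    intro k
    have h := List.abs_sum_map_mul_le (transferWords (List.ofFn k)) (fun _ => (2 : ℝ))
      (fun l => 2 * e (List.ofFn k) * w (List.ofFn k) * z l) (S := (B + 1) * S + Q / (B + 1)) ?_
    · refine le_trans (le_of_eq ?_) ((le_abs_self _).trans h)
      rw [← List.sum_map_mul_left]
      congr 2; funext l; ring
    · intro l hl
      have hlen : l.length = n := by simpa using length_of_mem_transferWords hl
      have hw := single w (List.ofFn k) (by simp)
      have hz := single z l hlen
      have hel : e l = e (List.ofFn k) := by
        simp only [he, weight_of_mem_transferWords h02 hl]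
      rw [hel] at hz
      have hB1 : 0 < B + 1 := by linarith
      have key : |2 * w (List.ofFn k) * z l| ≤
          (B + 1) * w (List.ofFn k) ^ 2 + z l ^ 2 / (B + 1) := by
        rw [← sub_nonneg]
        have h1 : (B + 1) * w (List.ofFn k) ^ 2 + z l ^ 2 / (B + 1) - |2 * w (List.ofFn k) * z l|
            = ((B + 1) * |w (List.ofFn k)| - |z l|) ^ 2 / (B + 1) := by
          rw [abs_mul, abs_mul, abs_two, ← sq_abs (w _), ← sq_abs (z l)]
          field_simp
          ring
        rw [h1]; positivity
      calc |2 * e (List.ofFn k) * w (List.ofFn k) * z l|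
          = e (List.ofFn k) * |2 * w (List.ofFn k) * z l| := by
            rw [← abs_of_pos (he0 (List.ofFn k)), ← abs_mul, abs_of_pos (he0 (List.ofFn k))]
            ring_nf
        _ ≤ e (List.ofFn k) * ((B + 1) * w (List.ofFn k) ^ 2 + z l ^ 2 / (B + 1)) :=
            mul_le_mul_of_nonneg_left key (he0 _).le
        _ = (B + 1) * (e (List.ofFn k) * w (List.ofFn k) ^ 2) +
            e (List.ofFn k) * z l ^ 2 / (B + 1) := by ring
        _ ≤ (B + 1) * S + Q / (B + 1) := by gcongr
  have hrem : ∀ k : Fin n → Fin (N + 2),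
      2 * e (List.ofFn k) * w (List.ofFn k) *
        ((remainderWords (List.ofFn k)).map fun q => q.1 * w q.2).sum ≤ cA k * (2 * S) := by
    intro k
    have h := List.abs_sum_map_mul_le (remainderWords (List.ofFn k)) (fun q => q.1)
      (fun q => 2 * e (List.ofFn k) * w (List.ofFn k) * w q.2) (S := 2 * S) ?_
    · refine le_trans (le_of_eq ?_) ((le_abs_self _).trans h)
      rw [← List.sum_map_mul_left]
      congr 2; funext l; ring
    · intro q hq
      have hlen : q.2.length = n := by simpa using length_of_mem_remainderWords hq
      have hw := single w (List.ofFn k) (by simp)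
      have hz := single w q.2 hlen
      have hel : e (List.ofFn k) ≤ e q.2 := by
        simp only [he]
        exact Real.exp_le_exp.2 (mul_le_mul_of_nonneg_right
          (weight_le_of_mem_remainderWords h02 hmono hq) hτ)
      have h1 : e (List.ofFn k) * w q.2 ^ 2 ≤ e q.2 * w q.2 ^ 2 := by gcongr
      have e0 := (he0 (List.ofFn k)).le
      have p1 := mul_nonneg e0 (sq_nonneg (w (List.ofFn k) + w q.2))
      have p2 := mul_nonneg e0 (sq_nonneg (w (List.ofFn k) - w q.2))
      rw [abs_le]
      constructor <;> nlinarith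
  have hmain : ∀ k : Fin n → Fin (N + 2),
      C * (e (List.ofFn k) * w (List.ofFn k) ^ 2) + 2 * (e (List.ofFn k) * z (List.ofFn k) ^ 2) -
        (cB k * ((B + 1) * S + Q / (B + 1)) + cA k * (2 * S)) ≤
      e (List.ofFn k) * ((2 * lam * (∑ j, κ (k j)) - ∑ j, m (k j)) * w (List.ofFn k) ^ 2 +
          2 * z (List.ofFn k) ^ 2 -
          2 * w (List.ofFn k) *
            (((transferWords (List.ofFn k)).map fun l => 2 * z l).sum +
             ((remainderWords (List.ofFn k)).map fun q => q.1 * w q.2).sum)) := by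
    intro k
    have h1 : C * (e (List.ofFn k) * w (List.ofFn k) ^ 2) ≤
        (2 * lam * (∑ j, κ (k j)) - ∑ j, m (k j)) * (e (List.ofFn k) * w (List.ofFn k) ^ 2) :=
      mul_le_mul_of_nonneg_right (hlam lam hl k) (mul_nonneg (he0 _).le (sq_nonneg _))
    have h2 := htransfer k
    have h3 := hrem k
    linarith
  refine le_trans ?_ (Finset.sum_le_sum fun k _ => hmain k)
  rw [Finset.sum_sub_distrib, Finset.sum_add_distrib, Finset.sum_add_distrib, ← Finset.mul_sum,
    ← Finset.mul_sum, ← Finset.sum_mul, ← Finset.sum_mul, ← hS, ← hQ, ← hB, ← hA]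
  have hBQ : B * (Q / (B + 1)) ≤ Q := by
    rw [mul_div_assoc', div_le_iff₀ (by linarith)]
    nlinarith
  nlinarith

end Energy

/-! ### Vector fields as operators on smooth functions -/

section Operators

variable {d : ℕ}

theorem two_le_infty : (2 : WithTop ℕ∞) ≤ ∞ :=
  WithTop.coe_le_coe.2 (le_top : (2 : ℕ∞) ≤ ⊤)

theorem ContDiff.fieldDeriv {V : EuclideanSpace ℝ (Fin d) → EuclideanSpace ℝ (Fin d)}
    {f : EuclideanSpace ℝ (Fin d) → ℝ} (hV : ContDiff ℝ ∞ V) (hf : ContDiff ℝ ∞ f) :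
    ContDiff ℝ ∞ (fieldDeriv V f) :=
  (hf.fderiv_right (m := ∞) (by simp)).clm_apply hV

/-- Smooth real functions on `ℝᵈ`, the space on which vector fields act as operators. -/
def smoothFunctions (d : ℕ) : Submodule ℝ (EuclideanSpace ℝ (Fin d) → ℝ) where
  carrier := {f | ContDiff ℝ ∞ f}
  add_mem' {f g} (hf : ContDiff ℝ ∞ f) (hg : ContDiff ℝ ∞ g) := hf.add hg
  zero_mem' := show ContDiff ℝ ∞ fun _ => (0 : ℝ) from contDiff_const
  smul_mem' c f (hf : ContDiff ℝ ∞ f) := hf.const_smul c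

theorem smoothFunctions.contDiff (f : smoothFunctions d) : ContDiff ℝ ∞ f.1 := f.2

/-- A smooth vector field as a linear operator on smooth functions. -/
noncomputable def fieldOperator (V : EuclideanSpace ℝ (Fin d) → EuclideanSpace ℝ (Fin d))
    (hV : ContDiff ℝ ∞ V) : Module.End ℝ (smoothFunctions d) where
  toFun f := ⟨fieldDeriv V f, hV.fieldDeriv f.2⟩
  map_add' f g := by
    ext x
    have hf := ((smoothFunctions.contDiff f).differentiable (by simp)).differentiableAt (x := x)
    have hg := ((smoothFunctions.contDiff g).differentiable (by simp)).differentiableAt (x := x)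
    change fderiv ℝ (f.1 + g.1) x (V x) = fderiv ℝ f.1 x (V x) + fderiv ℝ g.1 x (V x)
    rw [fderiv_add hf hg]; rfl
  map_smul' c f := by
    ext x
    have hf := ((smoothFunctions.contDiff f).differentiable (by simp)).differentiableAt (x := x)
    change fderiv ℝ (c • f.1) x (V x) = c * fderiv ℝ f.1 x (V x)
    rw [fderiv_const_smul hf]; rfl

theorem fieldDeriv_sub_fieldDeriv_eq_lieBracket
    {V W : EuclideanSpace ℝ (Fin d) → EuclideanSpace ℝ (Fin d)}
    {f : EuclideanSpace ℝ (Fin d) → ℝ} (hV : ContDiff ℝ ∞ V) (hW : ContDiff ℝ ∞ W)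
    (hf : ContDiff ℝ ∞ f) (x : EuclideanSpace ℝ (Fin d)) :
    fieldDeriv V (fieldDeriv W f) x - fieldDeriv W (fieldDeriv V f) x =
      fieldDeriv (VectorField.lieBracket ℝ V W) f x := by
  have hdf : DifferentiableAt ℝ (fderiv ℝ f) x :=
    ((hf.fderiv_right (m := ∞) (by simp)).differentiable (by simp)).differentiableAt
  have hdV : DifferentiableAt ℝ V x := (hV.differentiable (by simp)).differentiableAt
  have hdW : DifferentiableAt ℝ W x := (hW.differentiable (by simp)).differentiableAt
  have hsymm : IsSymmSndFDerivAt ℝ f x := hf.contDiffAt.isSymmSndFDerivAt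
    (by simpa using two_le_infty)
  have h1 : ∀ U : EuclideanSpace ℝ (Fin d) → EuclideanSpace ℝ (Fin d),
      DifferentiableAt ℝ U x → ∀ v, fderiv ℝ (fieldDeriv U f) x v =
        fderiv ℝ f x (fderiv ℝ U x v) + fderiv ℝ (fderiv ℝ f) x v (U x) := by
    intro U hU v
    change fderiv ℝ (fun y => fderiv ℝ f y (U y)) x v = _
    rw [fderiv_clm_apply hdf hU]
    simp
  change fderiv ℝ (fieldDeriv W f) x (V x) - fderiv ℝ (fieldDeriv V f) x (W x) =
    fderiv ℝ f x (fderiv ℝ W x (V x) - fderiv ℝ V x (W x))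
  rw [h1 W hdW, h1 V hdV, map_sub, hsymm.eq (V x) (W x)]
  ring

theorem fieldOperator_mul {V W U : EuclideanSpace ℝ (Fin d) → EuclideanSpace ℝ (Fin d)}
    (hV : ContDiff ℝ ∞ V) (hW : ContDiff ℝ ∞ W) {c : ℝ} (hU : ContDiff ℝ ∞ U)
    (h : VectorField.lieBracket ℝ V W = c • U) :
    fieldOperator V hV * fieldOperator W hW =
      fieldOperator W hW * fieldOperator V hV + c • fieldOperator U hU := by
  ext f x
  have key := fieldDeriv_sub_fieldDeriv_eq_lieBracket hV hW f.2 x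
  have h2 : fieldDeriv (VectorField.lieBracket ℝ V W) f x = c * fieldDeriv U f x := by
    rw [h]
    exact (fderiv ℝ f.1 x).map_smul c (U x)
  rw [h2] at key
  change fieldDeriv V (fieldDeriv W f) x =
    fieldDeriv W (fieldDeriv V f) x + c * fieldDeriv U f x
  linarith

variable {N : ℕ}

/-- The iterated derivative `Y_l f` along a word given as a list. -/
noncomputable def wordDeriv (Y : Fin (N + 2) → EuclideanSpace ℝ (Fin d) → EuclideanSpace ℝ (Fin d))
    (l : List (Fin (N + 2))) (f : EuclideanSpace ℝ (Fin d) → ℝ) : EuclideanSpace ℝ (Fin d) → ℝ :=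
  l.foldr (fun i g => fieldDeriv (Y i) g) f

theorem coe_prod_fieldOperator_apply
    {Y : Fin (N + 2) → EuclideanSpace ℝ (Fin d) → EuclideanSpace ℝ (Fin d)}
    (hY : ∀ i, ContDiff ℝ ∞ (Y i)) (l : List (Fin (N + 2))) (f : smoothFunctions d) :
    (((l.map fun i => fieldOperator (Y i) (hY i)).prod f : smoothFunctions d) :
      EuclideanSpace ℝ (Fin d) → ℝ) = wordDeriv Y l f := by
  induction l with
  | nil => rfl
  | cons i l ih =>
    rw [List.map_cons, List.prod_cons]
    change fieldDeriv (Y i) (((l.map fun i => fieldOperator (Y i) (hY i)).prod f :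
      smoothFunctions d) : EuclideanSpace ℝ (Fin d) → ℝ) = fieldDeriv (Y i) (wordDeriv Y l f)
    rw [ih]

theorem ContDiff.wordDeriv
    {Y : Fin (N + 2) → EuclideanSpace ℝ (Fin d) → EuclideanSpace ℝ (Fin d)}
    {f : EuclideanSpace ℝ (Fin d) → ℝ}
    (hY : ∀ i, ContDiff ℝ ∞ (Y i)) (hf : ContDiff ℝ ∞ f) (l : List (Fin (N + 2))) :
    ContDiff ℝ ∞ (wordDeriv Y l f) := by
  induction l with
  | nil => exact hf
  | cons i l ih => exact (hY i).fieldDeriv ih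

theorem list_sum_apply_apply {ι : Type*} (L : List ι) (T : ι → Module.End ℝ (smoothFunctions d))
    (f : smoothFunctions d) (x : EuclideanSpace ℝ (Fin d)) :
    ((L.map T).sum f : smoothFunctions d).1 x = (L.map fun i => (T i f).1 x).sum := by
  induction L with
  | nil => rfl
  | cons a L ih =>
    simp only [List.map_cons, List.sum_cons, ← ih]
    rfl

/-- Commuting a word past the generator, applied to a smooth function. -/
theorem wordDeriv_generator
    {Y : Fin (N + 2) → EuclideanSpace ℝ (Fin d) → EuclideanSpace ℝ (Fin d)}
    {D : EuclideanSpace ℝ (Fin d) → EuclideanSpace ℝ (Fin d)} {κ : Fin (N + 2) → ℝ} (hN : 1 ≤ N)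
    (h : IsFiliformWithDilation Y D κ) (lam : ℝ) (l : List (Fin (N + 2)))
    {f : EuclideanSpace ℝ (Fin d) → ℝ} (hf : ContDiff ℝ ∞ f) (x : EuclideanSpace ℝ (Fin d)) :
    wordDeriv Y l (generator Y D lam f) x =
      generator Y D lam (wordDeriv Y l f) x - lam * (l.map κ).sum * wordDeriv Y l f x +
      (((transferWords l).map fun l' => 2 * fieldDeriv (Y 1) (wordDeriv Y l' f) x).sum +
       ((remainderWords l).map fun q => q.1 * wordDeriv Y q.2 f x).sum) := by
  set y : Fin (N + 2) → Module.End ℝ (smoothFunctions d) :=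
    fun i => fieldOperator (Y i) (h.smooth_Y i) with hy
  set δ : Module.End ℝ (smoothFunctions d) := fieldOperator D h.smooth_D with hδ
  have h10 : (1 : Fin (N + 2)) ≠ 0 := by simp
  have h20 : (2 : Fin (N + 2)) ≠ 0 := by
    rw [Ne, Fin.ext_iff]
    change ¬ 2 % (N + 2) = 0 % (N + 2)
    rw [Nat.mod_eq_of_lt (by omega), Nat.zero_mod]
    omega
  have hsucc : ∀ i, i ≠ 0 → i ≠ Fin.last (N + 1) → y 0 * y i = y i * y 0 + y (i + 1) := by
    intro i hi hl
    obtain ⟨j, rfl⟩ := Fin.exists_castSucc_eq.2 hl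
    have hj : j ≠ 0 := by rintro rfl; simp at hi
    have := fieldOperator_mul (h.smooth_Y 0) (h.smooth_Y j.castSucc) (c := 1)
      (h.smooth_Y (j.castSucc + 1)) (by rw [h.bracket_succ j hj, Fin.coeSucc_eq_succ, one_smul])
    simpa using this
  have hcomm0 : ∀ i j, VectorField.lieBracket ℝ (Y i) (Y j) = 0 → y i * y j = y j * y i := by
    intro i j hij
    have := fieldOperator_mul (h.smooth_Y i) (h.smooth_Y j) (c := 0) (h.smooth_Y 0)
      (by rw [hij, zero_smul])
    simpa using this
  have h1l : (1 : Fin (N + 2)) ≠ Fin.last (N + 1) := by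
    rw [Ne, Fin.ext_iff]; simp; omega
  set W := (l.map y).prod with hW
  have hop : W * (y 1 * y 1 + y 0 - lam • δ) = (y 1 * y 1 + y 0 - lam • δ) * W -
      (lam * (l.map κ).sum) • W +
      (((transferWords l).map fun l => (2 : ℝ) • (y 1 * (l.map y).prod)).sum +
      ((remainderWords l).map fun q => q.1 • (q.2.map y).prod).sum) :=
    word_mul_generator y δ κ lam (by rw [hsucc 1 h10 h1l]; congr 2) hsucc
      (hcomm0 _ _ h.bracket_last) (fun i hi => hcomm0 _ _ (h.bracket_comm i 1 hi h10)) h20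
      (fun i => fieldOperator_mul (h.smooth_Y i) h.smooth_D (h.smooth_Y i) (h.bracket_dilation i)) l
  have happ := congrArg (fun T : Module.End ℝ (smoothFunctions d) => (T ⟨f, hf⟩).1 x) hop
  have e1 : ∀ l' (g : smoothFunctions d), ((l'.map y).prod g).1 = wordDeriv Y l' g :=
    fun l' g => coe_prod_fieldOperator_apply h.smooth_Y l' g
  have e2 : ∀ g : smoothFunctions d, ((y 1 * y 1 + y 0 - lam • δ) g).1 = generator Y D lam g :=
    fun g => rfl
  have lhs : ((W * (y 1 * y 1 + y 0 - lam • δ)) ⟨f, hf⟩).1 x =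
      wordDeriv Y l (generator Y D lam f) x := by
    change (W ((y 1 * y 1 + y 0 - lam • δ) ⟨f, hf⟩)).1 x = _
    rw [hW, e1, e2]
  have rhs : ((y 1 * y 1 + y 0 - lam • δ) (W ⟨f, hf⟩)).1 x =
      generator Y D lam (wordDeriv Y l f) x := by
    rw [e2, hW, e1]
  have s1 := list_sum_apply_apply (transferWords l)
    (fun l => (2 : ℝ) • (y 1 * (l.map y).prod)) ⟨f, hf⟩ x
  have s2 := list_sum_apply_apply (remainderWords l)
    (fun q => q.1 • (q.2.map y).prod) ⟨f, hf⟩ x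
  have t1 : ∀ l' : List (Fin (N + 2)), (((2 : ℝ) • (y 1 * (l'.map y).prod)) ⟨f, hf⟩).1 x =
      2 * fieldDeriv (Y 1) (wordDeriv Y l' f) x := by
    intro l'
    change 2 * fieldDeriv (Y 1) ((l'.map y).prod ⟨f, hf⟩).1 x = _
    rw [e1]
  have t2 : ∀ q : ℝ × List (Fin (N + 2)), ((q.1 • (q.2.map y).prod) ⟨f, hf⟩).1 x =
      q.1 * wordDeriv Y q.2 f x := by
    intro q
    change q.1 * ((q.2.map y).prod ⟨f, hf⟩).1 x = _
    rw [e1]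
  simp only [t1] at s1
  simp only [t2] at s2
  rw [← lhs, ← rhs, ← s1, ← s2, ← e1 l ⟨f, hf⟩]
  exact happ

theorem fieldDeriv_sum_mul_sq {ι : Type*} (s : Finset ι) (c : ι → ℝ)
    {V : EuclideanSpace ℝ (Fin d) → EuclideanSpace ℝ (Fin d)}
    {w : ι → EuclideanSpace ℝ (Fin d) → ℝ} (hw : ∀ i, ContDiff ℝ ∞ (w i)) :
    fieldDeriv V (fun x => ∑ i ∈ s, c i * w i x ^ 2) =
      fun x => ∑ i ∈ s, c i * (2 * w i x * fieldDeriv V (w i) x) := by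
  funext x
  have hd : ∀ i, HasFDerivAt (w i) (fderiv ℝ (w i) x) x := fun i =>
    ((hw i).differentiable (by simp)).differentiableAt.hasFDerivAt
  have := HasFDerivAt.fun_sum (u := s) fun i _ => ((hd i).pow 2).const_mul (c i)
  unfold fieldDeriv
  rw [this.fderiv]
  simp

/-- The carré du champ identity `L(w²) = 2 w L w + 2 (Y₁ w)²`, summed with constant weights. -/
theorem generator_sum_mul_sq {ι : Type*} (s : Finset ι) (c : ι → ℝ)
    {Y : Fin (N + 2) → EuclideanSpace ℝ (Fin d) → EuclideanSpace ℝ (Fin d)}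
    {D : EuclideanSpace ℝ (Fin d) → EuclideanSpace ℝ (Fin d)} (lam : ℝ)
    (hY : ∀ i, ContDiff ℝ ∞ (Y i))
    {w : ι → EuclideanSpace ℝ (Fin d) → ℝ} (hw : ∀ i, ContDiff ℝ ∞ (w i))
    (x : EuclideanSpace ℝ (Fin d)) :
    generator Y D lam (fun x => ∑ i ∈ s, c i * w i x ^ 2) x =
      ∑ i ∈ s, c i *
        (2 * w i x * generator Y D lam (w i) x + 2 * fieldDeriv (Y 1) (w i) x ^ 2) := by
  have hsecond : fieldDeriv (Y 1)
      (fun x => ∑ i ∈ s, c i * (2 * w i x * fieldDeriv (Y 1) (w i) x)) x =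
      ∑ i ∈ s, c i * (2 * w i x * fieldDeriv (Y 1) (fieldDeriv (Y 1) (w i)) x +
        2 * fieldDeriv (Y 1) (w i) x ^ 2) := by
    have hd : ∀ i, HasFDerivAt (w i) (fderiv ℝ (w i) x) x := fun i =>
      ((hw i).differentiable (by simp)).differentiableAt.hasFDerivAt
    have hd' : ∀ i, HasFDerivAt (fieldDeriv (Y 1) (w i)) (fderiv ℝ (fieldDeriv (Y 1) (w i)) x) x :=
      fun i => (((hY 1).fieldDeriv (hw i)).differentiable (by simp)).differentiableAt.hasFDerivAt
    have hsum : HasFDerivAt (fun x => ∑ i ∈ s, c i * (2 * w i x * fieldDeriv (Y 1) (w i) x)) _ x :=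
      HasFDerivAt.fun_sum (u := s) fun i _ => (((hd i).const_mul 2).mul (hd' i)).const_mul (c i)
    change fderiv ℝ _ x (Y 1 x) = _
    rw [hsum.fderiv, sum_apply]
    refine Finset.sum_congr rfl fun i _ => ?_
    simp only [smul_apply, add_apply, smul_eq_mul]
    simp only [fieldDeriv]
    ring
  unfold generator
  rw [fieldDeriv_sum_mul_sq s c hw, hsecond, fieldDeriv_sum_mul_sq s c hw,
    fieldDeriv_sum_mul_sq s c hw, Finset.mul_sum, ← Finset.sum_add_distrib,
    ← Finset.sum_sub_distrib]
  refine Finset.sum_congr rfl fun i _ => ?_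
  ring

end Operators

/-! ### Time derivatives and the subsolution property -/

section TimeDerivative

variable {d N : ℕ}

theorem fieldDeriv_eq_fderiv_uncurry {u : ℝ → EuclideanSpace ℝ (Fin d) → ℝ}
    (V : EuclideanSpace ℝ (Fin d) → EuclideanSpace ℝ (Fin d))
    {p : ℝ × EuclideanSpace ℝ (Fin d)} (hu : DifferentiableAt ℝ (fun q => u q.1 q.2) p) :
    fieldDeriv V (u p.1) p.2 = fderiv ℝ (fun q => u q.1 q.2) p (0, V p.2) := by
  have h1 : HasFDerivAt (fun y : EuclideanSpace ℝ (Fin d) => (p.1, y))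
      ((0 : EuclideanSpace ℝ (Fin d) →L[ℝ] ℝ).prod (ContinuousLinearMap.id ℝ _)) p.2 :=
    (hasFDerivAt_const p.1 p.2).prodMk (hasFDerivAt_id p.2)
  have h2 := HasFDerivAt.comp (g := fun q : ℝ × EuclideanSpace ℝ (Fin d) => u q.1 q.2) p.2
    (by exact hu.hasFDerivAt) h1
  have h3 : fderiv ℝ (u p.1) p.2 = _ := h2.fderiv
  rw [fieldDeriv, h3]
  simp

theorem isOpen_Ioi_prod_univ {d : ℕ} :
    IsOpen (Ioi (0 : ℝ) ×ˢ (univ : Set (EuclideanSpace ℝ (Fin d)))) :=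
  isOpen_Ioi.prod isOpen_univ

theorem ContDiffOn.fieldDeriv_slice {u : ℝ → EuclideanSpace ℝ (Fin d) → ℝ}
    {V : EuclideanSpace ℝ (Fin d) → EuclideanSpace ℝ (Fin d)} (hV : ContDiff ℝ ∞ V)
    (hu : ContDiffOn ℝ ∞ (fun p : ℝ × EuclideanSpace ℝ (Fin d) => u p.1 p.2) (Ioi 0 ×ˢ univ)) :
    ContDiffOn ℝ ∞ (fun p : ℝ × EuclideanSpace ℝ (Fin d) => fieldDeriv V (u p.1) p.2)
      (Ioi 0 ×ˢ univ) := by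
  have h1 := hu.fderiv_of_isOpen (m := ∞) isOpen_Ioi_prod_univ (by simp)
  have h2 : ContDiff ℝ ∞ (fun p : ℝ × EuclideanSpace ℝ (Fin d) => ((0 : ℝ), V p.2)) :=
    contDiff_const.prodMk (hV.comp contDiff_snd)
  refine (h1.clm_apply h2.contDiffOn).congr fun p hp => ?_
  exact fieldDeriv_eq_fderiv_uncurry V
    ((hu.contDiffAt (isOpen_Ioi_prod_univ.mem_nhds hp)).differentiableAt (by simp))

/-- Differentiation in time commutes with a vector field, by symmetry of second derivatives. -/
theorem hasDerivAt_fieldDeriv {u u' : ℝ → EuclideanSpace ℝ (Fin d) → ℝ}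
    (V : EuclideanSpace ℝ (Fin d) → EuclideanSpace ℝ (Fin d))
    (hu : ContDiffOn ℝ ∞ (fun p : ℝ × EuclideanSpace ℝ (Fin d) => u p.1 p.2) (Ioi 0 ×ˢ univ))
    (hu' : ContDiffOn ℝ ∞ (fun p : ℝ × EuclideanSpace ℝ (Fin d) => u' p.1 p.2) (Ioi 0 ×ˢ univ))
    (h : ∀ t, 0 < t → ∀ x, HasDerivAt (fun s => u s x) (u' t x) t)
    {t : ℝ} (ht : 0 < t) (x : EuclideanSpace ℝ (Fin d)) :
    HasDerivAt (fun s => fieldDeriv V (u s) x) (fieldDeriv V (u' t) x) t := by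
  set U : ℝ × EuclideanSpace ℝ (Fin d) → ℝ := fun p => u p.1 p.2 with hU
  have hmem : ∀ s, 0 < s → ∀ y, (s, y) ∈ Ioi (0 : ℝ) ×ˢ (univ : Set (EuclideanSpace ℝ (Fin d))) :=
    fun s hs y => ⟨hs, mem_univ _⟩
  have hat : ∀ p ∈ Ioi (0 : ℝ) ×ˢ (univ : Set (EuclideanSpace ℝ (Fin d))), ContDiffAt ℝ ∞ U p :=
    fun p hp => hu.contDiffAt (isOpen_Ioi_prod_univ.mem_nhds hp)
  have htime : ∀ p ∈ Ioi (0 : ℝ) ×ˢ (univ : Set (EuclideanSpace ℝ (Fin d))),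
      u' p.1 p.2 = fderiv ℝ U p (1, 0) := by
    intro p hp
    have h1 : HasDerivAt (fun s : ℝ => (s, p.2)) ((1 : ℝ), (0 : EuclideanSpace ℝ (Fin d))) p.1 :=
      (hasDerivAt_id p.1).prodMk (hasDerivAt_const p.1 p.2)
    have h2 := HasFDerivAt.comp_hasDerivAt (l := U) p.1
      (by exact ((hat p hp).differentiableAt (by simp)).hasFDerivAt) h1
    exact (h p.1 hp.1 p.2).unique h2
  have hp := hmem t ht x
  have hdd : HasFDerivAt (fderiv ℝ U) (fderiv ℝ (fderiv ℝ U) (t, x)) (t, x) :=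
    (((hat _ hp).fderiv_right (m := ∞) (by simp)).differentiableAt (by simp)).hasFDerivAt
  have hsymm : IsSymmSndFDerivAt ℝ U (t, x) := (hat _ hp).isSymmSndFDerivAt
    (by simpa using two_le_infty)
  have hval : fieldDeriv V (u' t) x = fderiv ℝ (fderiv ℝ U) (t, x) (1, 0) (0, V x) := by
    rw [fieldDeriv_eq_fderiv_uncurry (p := (t, x)) V
      ((hu'.contDiffAt (isOpen_Ioi_prod_univ.mem_nhds hp)).differentiableAt (by simp))]
    have heq : (fun q : ℝ × EuclideanSpace ℝ (Fin d) => u' q.1 q.2) =ᶠ[nhds (t, x)]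
        fun q => fderiv ℝ U q (1, 0) := by
      filter_upwards [isOpen_Ioi_prod_univ.mem_nhds hp] with q hq using htime q hq
    rw [heq.fderiv_eq, fderiv_clm_apply hdd.differentiableAt (differentiableAt_const _)]
    simp [hsymm.eq (1, 0) (0, V x)]
  have h1 : HasDerivAt (fun s : ℝ => (s, x)) ((1 : ℝ), (0 : EuclideanSpace ℝ (Fin d))) t :=
    (hasDerivAt_id t).prodMk (hasDerivAt_const t x)
  have h2 := (HasFDerivAt.comp_hasDerivAt (l := fderiv ℝ U) t hdd h1).clm_apply
    (hasDerivAt_const t ((0 : ℝ), V x))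
  rw [hval]
  refine (h2.congr_deriv (by simp)).congr_of_eventuallyEq ?_
  filter_upwards [lt_mem_nhds ht] with s hs
  exact fieldDeriv_eq_fderiv_uncurry (p := (s, x)) V
    ((hat _ (hmem s hs x)).differentiableAt (by simp))

theorem ContDiffOn.slice {u : ℝ → EuclideanSpace ℝ (Fin d) → ℝ}
    (hu : ContDiffOn ℝ ∞ (fun p : ℝ × EuclideanSpace ℝ (Fin d) => u p.1 p.2) (Ioi 0 ×ˢ univ))
    {t : ℝ} (ht : 0 < t) : ContDiff ℝ ∞ (u t) := by
  have h : ContDiff ℝ ∞ (fun y : EuclideanSpace ℝ (Fin d) => (t, y)) :=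
    contDiff_const.prodMk contDiff_id
  exact hu.comp_contDiff h fun y => ⟨ht, mem_univ _⟩

variable {Y : Fin (N + 2) → EuclideanSpace ℝ (Fin d) → EuclideanSpace ℝ (Fin d)}

theorem ContDiffOn.wordDeriv_slice (hY : ∀ i, ContDiff ℝ ∞ (Y i))
    {u : ℝ → EuclideanSpace ℝ (Fin d) → ℝ}
    (hu : ContDiffOn ℝ ∞ (fun p : ℝ × EuclideanSpace ℝ (Fin d) => u p.1 p.2) (Ioi 0 ×ˢ univ))
    (l : List (Fin (N + 2))) :
    ContDiffOn ℝ ∞ (fun p : ℝ × EuclideanSpace ℝ (Fin d) => wordDeriv Y l (u p.1) p.2)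
      (Ioi 0 ×ˢ univ) := by
  induction l with
  | nil => exact hu
  | cons i l ih => exact ContDiffOn.fieldDeriv_slice (u := fun t => wordDeriv Y l (u t)) (hY i) ih

theorem hasDerivAt_wordDeriv (hY : ∀ i, ContDiff ℝ ∞ (Y i))
    {u u' : ℝ → EuclideanSpace ℝ (Fin d) → ℝ}
    (hu : ContDiffOn ℝ ∞ (fun p : ℝ × EuclideanSpace ℝ (Fin d) => u p.1 p.2) (Ioi 0 ×ˢ univ))
    (hu' : ContDiffOn ℝ ∞ (fun p : ℝ × EuclideanSpace ℝ (Fin d) => u' p.1 p.2) (Ioi 0 ×ˢ univ))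
    (h : ∀ t, 0 < t → ∀ x, HasDerivAt (fun s => u s x) (u' t x) t) (l : List (Fin (N + 2))) :
    ∀ t, 0 < t → ∀ x, HasDerivAt (fun s => wordDeriv Y l (u s) x) (wordDeriv Y l (u' t) x) t := by
  induction l with
  | nil => exact h
  | cons i l ih =>
    intro t ht x
    exact hasDerivAt_fieldDeriv (u := fun t => wordDeriv Y l (u t))
      (u' := fun t => wordDeriv Y l (u' t)) (Y i) (hu.wordDeriv_slice hY l)
      (hu'.wordDeriv_slice hY l) ih ht x

theorem ContDiffOn.generator_slice (hY : ∀ i, ContDiff ℝ ∞ (Y i))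
    {D : EuclideanSpace ℝ (Fin d) → EuclideanSpace ℝ (Fin d)} (hD : ContDiff ℝ ∞ D) (lam : ℝ)
    {u : ℝ → EuclideanSpace ℝ (Fin d) → ℝ}
    (hu : ContDiffOn ℝ ∞ (fun p : ℝ × EuclideanSpace ℝ (Fin d) => u p.1 p.2) (Ioi 0 ×ˢ univ)) :
    ContDiffOn ℝ ∞ (fun p : ℝ × EuclideanSpace ℝ (Fin d) => generator Y D lam (u p.1) p.2)
      (Ioi 0 ×ˢ univ) := by
  have h11 := ContDiffOn.fieldDeriv_slice (u := fun t => fieldDeriv (Y 1) (u t)) (hY 1)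
    (hu.fieldDeriv_slice (hY 1))
  exact (h11.add (hu.fieldDeriv_slice (hY 0))).sub
    (contDiffOn_const.mul (hu.fieldDeriv_slice hD))

theorem weightedGamma_eq_sum_wordDeriv (m : Fin (N + 2) → ℝ) (n : ℕ) (t : ℝ)
    (g : EuclideanSpace ℝ (Fin d) → ℝ) :
    weightedGamma Y m n t g = fun x => ∑ k : Fin n → Fin (N + 2),
      Real.exp ((∑ j, m (k j)) * t) * wordDeriv Y (List.ofFn k) g x ^ 2 := by
  funext x
  simp only [weightedGamma, sq_abs]
  rfl

theorem ContDiffOn.weightedGamma_slice (hY : ∀ i, ContDiff ℝ ∞ (Y i)) (m : Fin (N + 2) → ℝ) (n : ℕ)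
    {u : ℝ → EuclideanSpace ℝ (Fin d) → ℝ}
    (hu : ContDiffOn ℝ ∞ (fun p : ℝ × EuclideanSpace ℝ (Fin d) => u p.1 p.2) (Ioi 0 ×ˢ univ)) :
    ContDiffOn ℝ ∞ (fun p : ℝ × EuclideanSpace ℝ (Fin d) => weightedGamma Y m n p.1 (u p.1) p.2)
      (Ioi 0 ×ˢ univ) := by
  simp only [weightedGamma_eq_sum_wordDeriv]
  refine ContDiffOn.sum fun k _ => ContDiffOn.mul ?_ ((hu.wordDeriv_slice hY _).pow 2)
  exact (contDiff_const.mul contDiff_fst).exp.contDiffOn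

/-- The weighted sum of squares is a subsolution: its time derivative is at most its generator. -/
theorem exists_deriv_weightedGamma_le_generator (hN : 1 ≤ N) {κ : Fin (N + 2) → ℝ}
    (hκ : ∀ i, 0 < κ i) {m : Fin (N + 2) → ℝ} (h02 : m 0 = m 2)
    (hmono : ∀ j : Fin (N + 1), j ≠ 0 → m j.castSucc ≤ m j.succ) (n : ℕ) :
    ∃ lam₀ : ℝ, 0 < lam₀ ∧ ∀ lam : ℝ, lam₀ ≤ lam →
      ∀ (d : ℕ) (Y : Fin (N + 2) → EuclideanSpace ℝ (Fin d) → EuclideanSpace ℝ (Fin d))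
        (D : EuclideanSpace ℝ (Fin d) → EuclideanSpace ℝ (Fin d)),
      IsFiliformWithDilation Y D κ → ∀ u : ℝ → EuclideanSpace ℝ (Fin d) → ℝ,
      ContDiffOn ℝ ∞ (fun p : ℝ × EuclideanSpace ℝ (Fin d) => u p.1 p.2) (Ioi 0 ×ˢ univ) →
      (∀ t, 0 < t → ∀ x, HasDerivAt (fun s => u s x) (generator Y D lam (u t) x) t) →
      ∀ t, 0 < t → ∀ x, ∃ c, HasDerivAt (fun s => weightedGamma Y m n s (u s) x) c t ∧
        c ≤ generator Y D lam (weightedGamma Y m n t (u t)) x := by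
  obtain ⟨lam₀, hpos, hmain⟩ := exists_forall_weighted_energy_nonneg hκ h02 (fun i hi hl => by
    obtain ⟨j, rfl⟩ := Fin.exists_castSucc_eq.2 hl
    rw [Fin.coeSucc_eq_succ]
    exact hmono j (by rintro rfl; simp at hi)) n
  refine ⟨lam₀, hpos, fun lam hlam d Y D h u hu heq t ht x => ?_⟩
  have hder := fun l => hasDerivAt_wordDeriv (u' := fun t => generator Y D lam (u t)) h.smooth_Y hu
    (hu.generator_slice h.smooth_Y h.smooth_D lam) heq l t ht x
  have hsum := HasDerivAt.fun_sum (u := Finset.univ) fun (k : Fin n → Fin (N + 2)) _ =>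
    (((hasDerivAt_id t).const_mul (∑ j, m (k j))).exp).mul ((hder (List.ofFn k)).pow 2)
  simp only [weightedGamma_eq_sum_wordDeriv]
  refine ⟨_, hsum, ?_⟩
  have hsm : ContDiff ℝ ∞ (u t) := hu.slice ht
  rw [generator_sum_mul_sq _ _ lam h.smooth_Y fun k => hsm.wordDeriv h.smooth_Y _, ← sub_nonneg,
    ← Finset.sum_sub_distrib]
  refine (hmain lam hlam t ht.le (fun l => wordDeriv Y l (u t) x)
    (fun l => fieldDeriv (Y 1) (wordDeriv Y l (u t)) x)).trans
    (le_of_eq (Finset.sum_congr rfl fun k _ => ?_))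
  have hκk : ((List.ofFn k).map κ).sum = ∑ j, κ (k j) := by
    simp [List.map_ofFn, List.sum_ofFn]
  rw [wordDeriv_generator hN h lam _ hsm, hκk]
  simp only [id, Pi.pow_apply]
  push_cast
  ring

end TimeDerivative

/-! ### Subsolutions along a diffusion -/

section Diffusion

variable {d : ℕ}

/-- A bounded smooth space-time subsolution gains in expectation along the diffusion: its local
martingale part has mean zero when stopped, and the stopping is removed by boundedness. -/
theorem IsDiffusion.le_integral {S : Type} [mS : MeasurableSpace S] {μ : Measure S}
    [IsProbabilityMeasure μ] {ℱ : Filtration ℝ≥0 mS}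
    {A : (EuclideanSpace ℝ (Fin d) → ℝ) → EuclideanSpace ℝ (Fin d) → ℝ}
    {x : EuclideanSpace ℝ (Fin d)} {X : ℝ≥0 → S → EuclideanSpace ℝ (Fin d)}
    (hX : IsDiffusion μ ℱ A x X) {φ : ℝ × EuclideanSpace ℝ (Fin d) → ℝ} (hφ : ContDiff ℝ ∞ φ)
    {T : ℝ≥0} (hT : 0 < T)
    (hsub : ∀ r ∈ Ioc (0 : ℝ) T, ∀ y,
      0 ≤ deriv (fun r => φ (r, y)) r + A (fun y => φ (r, y)) y)
    {C : ℝ} (hC : ∀ r ∈ Icc (0 : ℝ) T, ∀ y, |φ (r, y)| ≤ C) :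
    φ (0, x) ≤ ∫ w, φ (T, X T w) ∂μ := by
  obtain ⟨τ, hτ, hM⟩ := hX.martingaleProblem φ hφ
  have hC0 : 0 ≤ C := (abs_nonneg _).trans (hC 0 ⟨le_rfl, T.2⟩ x)
  have hXm : ∀ t, Measurable (X t) := fun t => ((hX.adapted t).mono (ℱ.le t)).measurable
  have hmeas : ∀ t : ℝ≥0, Measurable fun w => φ (t, X t w) := fun t =>
    hφ.continuous.measurable.comp (measurable_const.prodMk (hXm t))
  have hint : ∀ t : ℝ≥0, t ≤ T → Integrable (fun w => φ (t, X t w)) μ := fun t ht =>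
    Integrable.of_bound (hmeas t).aestronglyMeasurable C
      (ae_of_all _ fun w => hC t ⟨t.2, by exact_mod_cast ht⟩ _)
  set G : S → ℝ := fun w => φ (T, X T w) - φ (0, X 0 w) with hG
  have hGint : Integrable G μ := (hint T le_rfl).sub (by simpa using hint 0 hT.le)
  have hproc : ∀ (t : ℝ≥0), t ≤ T → ∀ w,
      martingaleProblemProcess A X φ t w ≤ φ (t, X t w) - φ (0, X 0 w) := by
    intro t ht w
    -- this holds without integrability, as the integral is then zero by convention
    have hnn : 0 ≤ ∫ s in (0 : ℝ)..(t : ℝ), (deriv (fun r => φ (r, X s.toNNReal w)) s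
        + A (fun y => φ (s, y)) (X s.toNNReal w)) := by
      rw [intervalIntegral.integral_of_le t.coe_nonneg]
      refine setIntegral_nonneg measurableSet_Ioc fun s hs => hsub s ⟨hs.1, hs.2.trans ?_⟩ _
      exact_mod_cast ht
    unfold martingaleProblemProcess
    linarith
  set B : ℕ → Set S := fun n => {w | τ n w < T} with hB
  have hBm : ∀ n, MeasurableSet (B n) := fun n =>
    ℱ.le T _ ((hτ.isStoppingTime n).measurableSet_lt T)
  have huntop : ∀ σ : ℝ≥0, (σ : WithTop ℝ≥0).untopA = σ := fun σ => WithTop.untopD_coe _ _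
  -- if the stopping occurs before `T`, the stopped process is at most `2 C`, and `G ≥ -2 C`
  have hle : ∀ n w, stoppedProcess (fun i => {w | ⊥ < τ n w}.indicator
      (martingaleProblemProcess A X φ i)) (τ n) T w ≤ G w + (B n).indicator (fun _ => 4 * C) w := by
    intro n w
    have hGw : -(2 * C) ≤ G w := by
      have h1 := abs_le.1 (hC T ⟨T.2, le_rfl⟩ (X T w))
      have h2 := abs_le.1 (hC 0 ⟨le_rfl, T.2⟩ (X 0 w))
      simp only [hG]; linarith
    simp only [stoppedProcess]
    by_cases hlt : τ n w < T
    · have hmem : w ∈ B n := hlt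
      rw [min_eq_right hlt.le, indicator_of_mem hmem]
      by_cases hbot : ⊥ < τ n w
      · rw [indicator_of_mem (show w ∈ {w | ⊥ < τ n w} from hbot)]
        obtain ⟨σ, hσ⟩ := WithTop.ne_top_iff_exists.1 (ne_top_of_lt hlt)
        rw [← hσ] at hlt ⊢
        have hσT : σ ≤ T := (WithTop.coe_lt_coe.1 hlt).le
        rw [huntop]
        have h := hproc σ hσT w
        have h1 := abs_le.1 (hC σ ⟨σ.2, by exact_mod_cast hσT⟩ (X σ w))
        have h2 := abs_le.1 (hC 0 ⟨le_rfl, T.2⟩ (X 0 w))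
        linarith
      · rw [indicator_of_notMem (show w ∉ {w | ⊥ < τ n w} from hbot)]
        linarith
    · have hmem : w ∉ B n := hlt
      have hge : (T : WithTop ℝ≥0) ≤ τ n w := not_lt.1 hlt
      have hbot : ⊥ < τ n w := lt_of_lt_of_le (WithTop.coe_lt_coe.2 hT) hge
      rw [min_eq_left hge, indicator_of_notMem hmem, huntop,
        indicator_of_mem (show w ∈ {w | ⊥ < τ n w} from hbot), add_zero]
      exact hproc T le_rfl w
  have hzero : ∀ n, ∫ w, stoppedProcess (fun i => {w | ⊥ < τ n w}.indicator
      (martingaleProblemProcess A X φ i)) (τ n) T w ∂μ = 0 := by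
    intro n
    rw [← integral_condExp (ℱ.le 0), integral_congr_ae ((hM n).condExp_ae_eq (zero_le : 0 ≤ T))]
    refine integral_eq_zero_of_ae (ae_of_all _ fun w => ?_)
    have hmin : min ((0 : ℝ≥0) : WithTop ℝ≥0) (τ n w) = ((0 : ℝ≥0) : WithTop ℝ≥0) :=
      min_eq_left bot_le
    simp only [stoppedProcess, hmin, huntop, Pi.zero_apply]
    exact indicator_apply_eq_zero.2 fun _ => by simp [martingaleProblemProcess]
  have hlim : Filter.Tendsto (fun n => ∫ w, (G w + (B n).indicator (fun _ => 4 * C) w) ∂μ)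
      Filter.atTop (nhds (∫ w, G w ∂μ)) := by
    refine tendsto_integral_of_dominated_convergence (fun w => |G w| + 4 * C)
      (fun n => (hGint.aestronglyMeasurable).add
        (measurable_const.indicator (hBm n)).aestronglyMeasurable)
      (hGint.abs.add (integrable_const _)) (fun n => ae_of_all _ fun w => ?_) ?_
    · refine (norm_add_le _ _).trans (add_le_add le_rfl ?_)
      refine (norm_indicator_le_norm_self _ _).trans ?_
      rw [Real.norm_of_nonneg (by linarith)]
    · filter_upwards [hτ.tendsto_top] with w hw
      refine tendsto_const_nhds.congr' ?_
      filter_upwards [hw.eventually (lt_mem_nhds (WithTop.coe_lt_top T))] with n hn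
      rw [indicator_of_notMem (show w ∉ B n from not_lt.2 hn.le), add_zero]
  have hGnn : 0 ≤ ∫ w, G w ∂μ := by
    refine ge_of_tendsto' hlim fun n => ?_
    rw [← hzero n]
    exact integral_mono ((hM n).integrable T)
      (hGint.add ((integrable_const _).indicator (hBm n))) (hle n)
  have hstart : ∫ w, φ (0, X 0 w) ∂μ = φ (0, x) := by
    have : (fun w => φ (0, X 0 w)) =ᵐ[μ] fun _ => φ (0, x) := by
      filter_upwards [hX.start] with w hw
      rw [hw]
    rw [integral_congr_ae this]
    simp
  have : ∫ w, G w ∂μ = ∫ w, φ (T, X T w) ∂μ - φ (0, x) := by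
    rw [← hstart]
    exact integral_sub (hint T le_rfl) (by simpa using hint 0 hT.le)
  linarith

end Diffusion

/-! ### Comparison with the semigroup -/

section Comparison

variable {d : ℕ}

/-- A smooth positive time change equal to `r ↦ t - r` up to a time later than `t - s`. It extends
functions defined for positive times only, run backwards from `t`, to all times. -/
theorem exists_smooth_pos_eq_sub {s t : ℝ} (hs : 0 < s) :
    ∃ χ : ℝ → ℝ, ContDiff ℝ ∞ χ ∧ (∀ r, 0 < χ r) ∧ ∀ r, r < t - s / 2 → χ r = t - r := by
  set σ : ℝ → ℝ := fun r => Real.smoothTransition ((r - (t - s / 2)) / (s / 4)) with hσ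
  have hσs : ContDiff ℝ ∞ σ :=
    Real.smoothTransition.contDiff.comp ((contDiff_id.sub contDiff_const).div_const _)
  refine ⟨fun r => (t - r) * (1 - σ r) + s * σ r, ?_, fun r => ?_, fun r hr => ?_⟩
  · exact ((contDiff_const.sub contDiff_id).mul (contDiff_const.sub hσs)).add
      (contDiff_const.mul hσs)
  · have h0 : 0 ≤ σ r := Real.smoothTransition.nonneg _
    have h1 : σ r ≤ 1 := Real.smoothTransition.le_one _
    by_cases hr : r < t
    · rcases h0.eq_or_lt with h | h
      · simp only [← h]; linarith
      · have := mul_nonneg (sub_nonneg.2 hr.le) (sub_nonneg.2 h1)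
        have := mul_pos hs h
        simp only; linarith
    · have h : σ r = 1 := Real.smoothTransition.one_of_one_le
        ((one_le_div (by linarith)).2 (by linarith))
      simp only [h]; linarith
  · have h : σ r = 0 := Real.smoothTransition.zero_of_nonpos
      (div_nonpos_of_nonpos_of_nonneg (by linarith) (by linarith))
    simp [h]

variable {A : (EuclideanSpace ℝ (Fin d) → ℝ) → EuclideanSpace ℝ (Fin d) → ℝ}

theorem IsDiffusion.subsolution_le_integral {S : Type} [mS : MeasurableSpace S] {μ : Measure S}
    [IsProbabilityMeasure μ] {ℱ : Filtration ℝ≥0 mS} {x : EuclideanSpace ℝ (Fin d)}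
    {X : ℝ≥0 → S → EuclideanSpace ℝ (Fin d)} (hX : IsDiffusion μ ℱ A x X)
    {Φ : ℝ → EuclideanSpace ℝ (Fin d) → ℝ}
    (hΦ : ContDiffOn ℝ ∞ (fun p : ℝ × EuclideanSpace ℝ (Fin d) => Φ p.1 p.2) (Ioi 0 ×ˢ univ))
    (hsub : ∀ t, 0 < t → ∀ x, ∃ c, HasDerivAt (fun s => Φ s x) c t ∧ c ≤ A (Φ t) x)
    (hbd : ∀ T : ℝ, ∃ C : ℝ, ∀ t ∈ Icc 0 T, ∀ x, |Φ t x| ≤ C) {s t : ℝ} (hs : 0 < s)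
    (hst : s < t) : Φ t x ≤ ∫ w, Φ s (X (t - s).toNNReal w) ∂μ := by
  obtain ⟨χ, hχs, hχ0, hχ⟩ := exists_smooth_pos_eq_sub (t := t) hs
  obtain ⟨C, hC⟩ := hbd t
  have hT : ((t - s).toNNReal : ℝ) = t - s := Real.coe_toNNReal _ (by linarith)
  have hφ : ContDiff ℝ ∞ fun p : ℝ × EuclideanSpace ℝ (Fin d) => Φ (χ p.1) p.2 :=
    hΦ.comp_contDiff ((hχs.comp contDiff_fst).prodMk contDiff_snd)
      fun p => ⟨hχ0 p.1, mem_univ _⟩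
  have h := hX.le_integral hφ (T := (t - s).toNNReal) (Real.toNNReal_pos.2 (by linarith))
    (fun r hr y => ?_) (C := C) (fun r hr y => ?_)
  · simp only [hT] at h
    rwa [hχ 0 (by linarith), hχ (t - s) (by linarith), sub_zero, sub_sub_cancel] at h
  · rw [hT] at hr
    have hr' : r < t - s / 2 := by linarith [hr.2]
    obtain ⟨c, hc, hcA⟩ := hsub (t - r) (by linarith) y
    have hder : HasDerivAt (fun r => Φ (χ r) y) (-c) r := by
      have h1 : HasDerivAt (fun r => Φ (t - r) y) (c * -1) r :=
        HasDerivAt.comp (h₂ := fun s => Φ s y) r hc ((hasDerivAt_id r).const_sub t)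
      rw [mul_neg_one] at h1
      refine h1.congr_of_eventuallyEq ?_
      filter_upwards [gt_mem_nhds hr'] with r' h'
      rw [hχ r' h']
    simp only [hder.deriv, hχ r hr']
    linarith
  · rw [hT] at hr
    simp only [hχ r (by linarith [hr.2])]
    exact hC _ ⟨by linarith [hr.2], by linarith [hr.1]⟩ y

/-- Comparison principle: a bounded subsolution, smooth for positive times and continuous up to
time zero, lies below its evolution under the semigroup. -/
theorem IsMarkovSemigroup.subsolution_le_semigroupApply
    {P : ℝ≥0 → Kernel (EuclideanSpace ℝ (Fin d)) (EuclideanSpace ℝ (Fin d))}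
    (hP : IsMarkovSemigroup A P) {Φ : ℝ → EuclideanSpace ℝ (Fin d) → ℝ}
    (hΦ : ContDiffOn ℝ ∞ (fun p : ℝ × EuclideanSpace ℝ (Fin d) => Φ p.1 p.2) (Ioi 0 ×ˢ univ))
    (hcont : ContinuousOn (fun p : ℝ × EuclideanSpace ℝ (Fin d) => Φ p.1 p.2) (Ici 0 ×ˢ univ))
    (hsub : ∀ t, 0 < t → ∀ x, ∃ c, HasDerivAt (fun s => Φ s x) c t ∧ c ≤ A (Φ t) x)
    (hbd : ∀ T : ℝ, ∃ C : ℝ, ∀ t ∈ Icc 0 T, ∀ x, |Φ t x| ≤ C) {s t : ℝ} (hs : 0 ≤ s)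
    (hst : s ≤ t) (x : EuclideanSpace ℝ (Fin d)) :
    Φ t x ≤ semigroupApply P (t - s) (Φ s) x := by
  obtain ⟨S, mS, μ, ℱ, X, hμ, hX, hlaw⟩ := hP.diffusion x
  have hXm : ∀ r, Measurable (X r) := fun r => ((hX.adapted r).mono (ℱ.le r)).measurable
  have hslice : ∀ r, 0 ≤ r → Continuous (Φ r) := fun r hr =>
    hcont.comp_continuous (Continuous.prodMk_right r) fun y => ⟨hr, mem_univ _⟩
  have happly : ∀ r, 0 ≤ r → semigroupApply P (t - r) (Φ r) x =
      ∫ w, Φ r (X (t - r).toNNReal w) ∂μ := by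
    intro r hr
    rw [semigroupApply, ← hlaw, integral_map (hXm _).aemeasurable
      (hslice r hr).aestronglyMeasurable]
  rcases hst.eq_or_lt with rfl | hst
  · rw [sub_self, semigroupApply, Real.toNNReal_zero, hP.zero, Kernel.id_apply, integral_dirac]
  rw [happly s hs]
  rcases hs.eq_or_lt with rfl | hs
  · -- time zero is reached by letting the initial time tend to zero from the right
    obtain ⟨C, hC⟩ := hbd t
    have hev : ∀ᶠ r in nhdsWithin (0 : ℝ) (Ioi 0), r ∈ Ioo 0 t := Ioo_mem_nhdsGT hst
    have hlim : Filter.Tendsto (fun r => ∫ w, Φ r (X (t - r).toNNReal w) ∂μ)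
        (nhdsWithin 0 (Ioi 0)) (nhds (∫ w, Φ 0 (X (t - 0).toNNReal w) ∂μ)) := by
      refine tendsto_integral_filter_of_dominated_convergence (fun _ => C) ?_ ?_
        (integrable_const _) (ae_of_all _ fun w => ?_)
      · filter_upwards [hev] with r hr
        exact ((hslice r hr.1.le).measurable.comp (hXm _)).aestronglyMeasurable
      · filter_upwards [hev] with r hr
        exact ae_of_all _ fun w => hC r ⟨hr.1.le, hr.2.le⟩ _
      · have hpath : Continuous fun r : ℝ => (r, X (t - r).toNNReal w) :=
          continuous_id.prodMk ((hX.continuous_paths w).comp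
            (continuous_real_toNNReal.comp (continuous_const.sub continuous_id)))
        have h0 : ContinuousWithinAt (fun p : ℝ × EuclideanSpace ℝ (Fin d) => Φ p.1 p.2)
            (Ici 0 ×ˢ univ) (0, X (t - 0).toNNReal w) := hcont _ ⟨self_mem_Ici, mem_univ _⟩
        have hpath0 : Filter.Tendsto (fun r : ℝ => (r, X (t - r).toNNReal w))
            (nhdsWithin 0 (Ioi 0)) (nhdsWithin (0, X (t - 0).toNNReal w) (Ici 0 ×ˢ univ)) := by
          refine tendsto_nhdsWithin_iff.2 ⟨?_, ?_⟩
          · exact (hpath.tendsto 0).mono_left nhdsWithin_le_nhds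
          · filter_upwards [hev] with r hr using ⟨hr.1.le, mem_univ _⟩
        exact h0.tendsto.comp hpath0
    refine ge_of_tendsto hlim ?_
    filter_upwards [hev] with r hr
    exact hX.subsolution_le_integral hΦ hsub hbd hr.1 hr.2
  · exact hX.subsolution_le_integral hΦ hsub hbd hs hst

theorem semigroupApply_le_iSup
    {P : ℝ≥0 → Kernel (EuclideanSpace ℝ (Fin d)) (EuclideanSpace ℝ (Fin d))} {t : ℝ}
    [IsMarkovKernel (P t.toNNReal)] {g : EuclideanSpace ℝ (Fin d) → ℝ}
    (hg : Continuous g) {C : ℝ} (hC : ∀ x, |g x| ≤ C) (x : EuclideanSpace ℝ (Fin d)) :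
    semigroupApply P t g x ≤ ⨆ y, g y := by
  have hb : BddAbove (range g) := ⟨C, by rintro _ ⟨y, rfl⟩; exact (le_abs_self _).trans (hC y)⟩
  have h := integral_mono (μ := P t.toNNReal x)
    (Integrable.of_bound hg.aestronglyMeasurable C (ae_of_all _ hC))
    (integrable_const (⨆ y, g y)) (le_ciSup hb)
  simpa [semigroupApply] using h

end Comparison

/-! ### Weighted sums along a regular trajectory -/

section Trajectory

variable {d N n : ℕ} {Y : Fin (N + 2) → EuclideanSpace ℝ (Fin d) → EuclideanSpace ℝ (Fin d)}
  {A : (EuclideanSpace ℝ (Fin d) → ℝ) → EuclideanSpace ℝ (Fin d) → ℝ}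
  {u : ℝ → EuclideanSpace ℝ (Fin d) → ℝ}

theorem IsRegularTrajectory.continuousOn_weightedGamma (hu : IsRegularTrajectory Y A n u)
    (m : Fin (N + 2) → ℝ) :
    ContinuousOn (fun p : ℝ × EuclideanSpace ℝ (Fin d) => weightedGamma Y m n p.1 (u p.1) p.2)
      (Ici 0 ×ˢ univ) := by
  unfold weightedGamma
  refine continuousOn_finsetSum _ fun k _ => ContinuousOn.mul ?_ ((hu.continuous_deriv k).abs.pow 2)
  exact (Real.continuous_exp.comp (continuous_const.mul continuous_fst)).continuousOn

theorem IsRegularTrajectory.continuous_weightedGamma (hu : IsRegularTrajectory Y A n u)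
    (m : Fin (N + 2) → ℝ) {t : ℝ} (ht : 0 ≤ t) : Continuous (weightedGamma Y m n t (u t)) :=
  (hu.continuousOn_weightedGamma m).comp_continuous (Continuous.prodMk_right t)
    fun _ => ⟨ht, mem_univ _⟩

theorem IsRegularTrajectory.exists_abs_weightedGamma_le (hu : IsRegularTrajectory Y A n u)
    (m : Fin (N + 2) → ℝ) (T : ℝ) :
    ∃ C : ℝ, ∀ t ∈ Icc 0 T, ∀ x, |weightedGamma Y m n t (u t) x| ≤ C := by
  choose C hC using fun k => hu.bounded_deriv k T
  refine ⟨∑ k : Fin n → Fin (N + 2), Real.exp (|∑ j, m (k j)| * T) * C k ^ 2, fun t ht x => ?_⟩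
  rw [weightedGamma, abs_of_nonneg (Finset.sum_nonneg fun k _ => by positivity)]
  refine Finset.sum_le_sum fun k _ => ?_
  have h1 : (∑ j, m (k j)) * t ≤ |∑ j, m (k j)| * T :=
    mul_le_mul (le_abs_self _) ht.2 ht.1 (abs_nonneg _)
  have h2 := hC k t ht x
  gcongr

theorem sq_abs_iterFieldDeriv_le (m : Fin (N + 2) → ℝ) (t : ℝ) (g : EuclideanSpace ℝ (Fin d) → ℝ)
    (x : EuclideanSpace ℝ (Fin d)) (k : Fin n → Fin (N + 2)) :
    |iterFieldDeriv Y k g x| ^ 2 ≤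
      Real.exp (-((∑ j, m (k j)) * t)) * weightedGamma Y m n t g x := by
  have h := Finset.single_le_sum (f := fun k : Fin n → Fin (N + 2) =>
    Real.exp ((∑ j, m (k j)) * t) * |iterFieldDeriv Y k g x| ^ 2)
    (fun k _ => by positivity) (Finset.mem_univ k)
  calc |iterFieldDeriv Y k g x| ^ 2
      = Real.exp (-((∑ j, m (k j)) * t)) *
          (Real.exp ((∑ j, m (k j)) * t) * |iterFieldDeriv Y k g x| ^ 2) := by
        rw [← mul_assoc, ← Real.exp_add, neg_add_cancel, Real.exp_zero, one_mul]
    _ ≤ _ := mul_le_mul_of_nonneg_left h (Real.exp_pos _).le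

theorem weightedGamma_mono {m m' : Fin (N + 2) → ℝ} (h : ∀ i, m i ≤ m' i) {t : ℝ} (ht : 0 ≤ t)
    (g : EuclideanSpace ℝ (Fin d) → ℝ) (x : EuclideanSpace ℝ (Fin d)) :
    weightedGamma Y m n t g x ≤ weightedGamma Y m' n t g x := by
  refine Finset.sum_le_sum fun k _ => ?_
  have h1 : (∑ j, m (k j)) * t ≤ (∑ j, m' (k j)) * t :=
    mul_le_mul_of_nonneg_right (Finset.sum_le_sum fun j _ => h _) ht
  gcongr

theorem weightedGamma_time_zero (m m' : Fin (N + 2) → ℝ) (g : EuclideanSpace ℝ (Fin d) → ℝ) :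
    weightedGamma Y m n 0 g = weightedGamma Y m' n 0 g := by
  funext x
  simp [weightedGamma]

end Trajectory

/-! ### Gradient bounds -/

/-- For weights with `m₀ = m₂` and `m₁ ≤ m₂ ≤ ⋯ ≤ m_{N+1}`, the weighted sum at time `t` is bounded
by the evolution of the weighted sum at any earlier time. -/
theorem exists_weightedGamma_le_semigroupApply {N : ℕ} (hN : 1 ≤ N) {κ : Fin (N + 2) → ℝ}
    (hκ : ∀ i, 0 < κ i) {m : Fin (N + 2) → ℝ} (h02 : m 0 = m 2)
    (hmono : ∀ j : Fin (N + 1), j ≠ 0 → m j.castSucc ≤ m j.succ) (n : ℕ) :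
    ∃ lam₀ : ℝ, 0 < lam₀ ∧ ∀ lam : ℝ, lam₀ ≤ lam →
      ∀ (d : ℕ) (Y : Fin (N + 2) → EuclideanSpace ℝ (Fin d) → EuclideanSpace ℝ (Fin d))
        (D : EuclideanSpace ℝ (Fin d) → EuclideanSpace ℝ (Fin d)),
      IsFiliformWithDilation Y D κ →
      ∀ P : ℝ≥0 → Kernel (EuclideanSpace ℝ (Fin d)) (EuclideanSpace ℝ (Fin d)),
      IsMarkovSemigroup (generator Y D lam) P → ∀ u : ℝ → EuclideanSpace ℝ (Fin d) → ℝ,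
      IsRegularTrajectory Y (generator Y D lam) n u → ∀ s t : ℝ, 0 ≤ s → s ≤ t → ∀ x,
      weightedGamma Y m n t (u t) x ≤
        semigroupApply P (t - s) (weightedGamma Y m n s (u s)) x := by
  obtain ⟨lam₀, hpos, h⟩ := exists_deriv_weightedGamma_le_generator hN hκ h02 hmono n
  refine ⟨lam₀, hpos, fun lam hlam d Y D hY P hP u hu s t hs hst x => ?_⟩
  exact hP.subsolution_le_semigroupApply (Φ := fun t => weightedGamma Y m n t (u t))
    (hu.smooth.weightedGamma_slice hY.smooth_Y m n) (hu.continuousOn_weightedGamma m)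
    (h lam hlam d Y D hY u hu.smooth hu.equation) (hu.exists_abs_weightedGamma_le m) hs hst x

theorem mainTheorem4 (N : ℕ) (hN : 1 ≤ N) (κ : Fin (N + 2) → ℝ) (hκ : ∀ i, 0 < κ i)
    (m : Fin (N + 2) → ℝ) (hm : ∀ i, 0 < m i) (n : ℕ) :
    ∃ lam₀ : ℝ, 0 < lam₀ ∧ ∀ lam : ℝ, lam₀ ≤ lam →
      ∀ (d : ℕ) (Y : Fin (N + 2) → EuclideanSpace ℝ (Fin d) → EuclideanSpace ℝ (Fin d))
        (D : EuclideanSpace ℝ (Fin d) → EuclideanSpace ℝ (Fin d)),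
      IsFiliformWithDilation Y D κ →
      ∀ P : ℝ≥0 → Kernel (EuclideanSpace ℝ (Fin d)) (EuclideanSpace ℝ (Fin d)),
      IsMarkovSemigroup (generator Y D lam) P →
      ∀ f : EuclideanSpace ℝ (Fin d) → ℝ,
      ContDiff ℝ ∞ f → (∃ C : ℝ, ∀ x, |f x| ≤ C) →
      IsRegularTrajectory Y (generator Y D lam) n (fun t => semigroupApply P t f) →
      -- pointwise bound along the semigroup, and decay of each derivative of order `n`
      (∀ t : ℝ, 0 < t → ∀ x,
        weightedGamma Y m n t (semigroupApply P t f) x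
            ≤ semigroupApply P t (weightedGamma Y m n 0 f) x ∧
        ∀ k : Fin n → Fin (N + 2),
          |iterFieldDeriv Y k (semigroupApply P t f) x| ^ 2
            ≤ Real.exp (-((∑ j, m (k j)) * t))
                * semigroupApply P t (weightedGamma Y m n 0 f) x) ∧
      -- the same bounds in the supremum norm
      (∀ t : ℝ, 0 < t →
        (⨆ x, weightedGamma Y m n t (semigroupApply P t f) x) ≤ ⨆ x, weightedGamma Y m n 0 f x) ∧
      (∀ t : ℝ, 0 < t → ∀ (k : Fin n → Fin (N + 2)) x,
        |iterFieldDeriv Y k (semigroupApply P t f) x| ^ 2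
          ≤ Real.exp (-((∑ j, m (k j)) * t)) * ⨆ y, weightedGamma Y m n 0 f y) ∧
      -- monotonicity in time for nondecreasing weights
      (m 0 = m 2 → (∀ j : Fin (N + 1), j ≠ 0 → m j.castSucc ≤ m j.succ) →
        (∀ s t : ℝ, 0 ≤ s → s ≤ t → ∀ x,
          weightedGamma Y m n t (semigroupApply P t f) x
            ≤ semigroupApply P (t - s) (weightedGamma Y m n s (semigroupApply P s f)) x) ∧
        AntitoneOn (fun t => ⨆ x, weightedGamma Y m n t (semigroupApply P t f) x) (Ici 0)) := by

  -- at time zero the weights are invisible, so the bounds from time zero follow from the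
  -- constant weight `c`, which dominates all the `m i` and is trivially monotone
  set c : ℝ := ∑ i, m i with hc
  have hmc : ∀ i, m i ≤ c := fun i =>
    Finset.single_le_sum (fun i _ => (hm i).le) (Finset.mem_univ i)
  obtain ⟨lam₁, hpos₁, h₁⟩ := exists_weightedGamma_le_semigroupApply hN hκ
    (m := fun _ => c) rfl (fun _ _ => le_rfl) n
  obtain ⟨lam₂, hpos₂, h₂⟩ : ∃ lam₂ : ℝ, 0 < lam₂ ∧ ∀ lam : ℝ, lam₂ ≤ lam → m 0 = m 2 →
      (∀ j : Fin (N + 1), j ≠ 0 → m j.castSucc ≤ m j.succ) →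
      ∀ (d : ℕ) (Y : Fin (N + 2) → EuclideanSpace ℝ (Fin d) → EuclideanSpace ℝ (Fin d))
        (D : EuclideanSpace ℝ (Fin d) → EuclideanSpace ℝ (Fin d)),
      IsFiliformWithDilation Y D κ →
      ∀ P : ℝ≥0 → Kernel (EuclideanSpace ℝ (Fin d)) (EuclideanSpace ℝ (Fin d)),
      IsMarkovSemigroup (generator Y D lam) P → ∀ u : ℝ → EuclideanSpace ℝ (Fin d) → ℝ,
      IsRegularTrajectory Y (generator Y D lam) n u → ∀ s t : ℝ, 0 ≤ s → s ≤ t → ∀ x,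
      weightedGamma Y m n t (u t) x ≤
        semigroupApply P (t - s) (weightedGamma Y m n s (u s)) x := by
    by_cases hmon : m 0 = m 2 ∧ ∀ j : Fin (N + 1), j ≠ 0 → m j.castSucc ≤ m j.succ
    · obtain ⟨lam₂, hpos, h⟩ := exists_weightedGamma_le_semigroupApply hN hκ hmon.1 hmon.2 n
      exact ⟨lam₂, hpos, fun lam hlam _ _ => h lam hlam⟩
    · exact ⟨1, one_pos, fun lam _ h02 hmono => absurd ⟨h02, hmono⟩ hmon⟩
  refine ⟨max lam₁ lam₂, lt_max_of_lt_left hpos₁, fun lam hlam d Y D hY P hP f hf _ hu => ?_⟩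
  have hzero : semigroupApply P 0 f = f := by
    funext x
    rw [semigroupApply, Real.toNNReal_zero, hP.zero, Kernel.id_apply, integral_dirac]
  have hmarkov : ∀ t, IsMarkovKernel (P t) := hP.markov
  have hsup : ∀ s t, 0 ≤ s → ∀ x,
      semigroupApply P t (weightedGamma Y m n s (semigroupApply P s f)) x ≤
        ⨆ y, weightedGamma Y m n s (semigroupApply P s f) y := by
    intro s t hs x
    obtain ⟨C, hC⟩ := hu.exists_abs_weightedGamma_le m s
    exact semigroupApply_le_iSup (hu.continuous_weightedGamma m hs) (hC s ⟨hs, le_rfl⟩) x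
  have hpoint : ∀ t : ℝ, 0 < t → ∀ x, weightedGamma Y m n t (semigroupApply P t f) x ≤
      semigroupApply P t (weightedGamma Y m n 0 f) x := by
    intro t ht x
    have h := h₁ lam ((le_max_left _ _).trans hlam) d Y D hY P hP _ hu 0 t le_rfl ht.le x
    rw [sub_zero, hzero, weightedGamma_time_zero _ m] at h
    exact (weightedGamma_mono hmc ht.le _ x).trans h
  have hsup0 : ∀ t x, semigroupApply P t (weightedGamma Y m n 0 f) x ≤
      ⨆ y, weightedGamma Y m n 0 f y := by
    intro t x
    simpa only [hzero] using hsup 0 t le_rfl x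
  have hword : ∀ t : ℝ, 0 < t → ∀ x (k : Fin n → Fin (N + 2)),
      |iterFieldDeriv Y k (semigroupApply P t f) x| ^ 2 ≤ Real.exp (-((∑ j, m (k j)) * t)) *
        semigroupApply P t (weightedGamma Y m n 0 f) x := fun t ht x k =>
    (sq_abs_iterFieldDeriv_le m t _ x k).trans
      (mul_le_mul_of_nonneg_left (hpoint t ht x) (Real.exp_pos _).le)
  refine ⟨fun t ht x => ⟨hpoint t ht x, hword t ht x⟩,
    fun t ht => ciSup_le fun x => (hpoint t ht x).trans (hsup0 t x),
    fun t ht k x => (hword t ht x k).trans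
      (mul_le_mul_of_nonneg_left (hsup0 t x) (Real.exp_pos _).le),
    fun h02 hmono => ?_⟩
  have h := h₂ lam ((le_max_right _ _).trans hlam) h02 hmono d Y D hY P hP _ hu
  exact ⟨h, fun s hs t _ hst => ciSup_le fun x => (h s t hs hst x).trans (hsup s _ hs x)⟩
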